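/- For an odd prime power $q$ and $n\ge 0$ let $B_q(n)$ be the number of monic $f\in\mathbb F_q[T]$ of degree $n$ of the form $f=A^2+TB^2$ with $A,B\in\mathbb F_q[T]$, and let $S^o_q(n)$ be the number of monic squarefree $f\in\mathbb F_q[T]$ of degree $n$ with $f(0)\neq 0$ such that $(-1)^n f=A^2-TB^2$ for some $A,B\in\mathbb F_q[T]$ (if $n$ is even or $q\equiv 1 \pmod 4$, this condition is equivalent to $f$ itself being of the form $A^2-TB^2$, so the sign may be dropped there). Put $h_k=\binom{2k}{k}/4^k$ for $k\ge 0$ and $h_k=0$ for $k<0$. Then $$S^o_q(n)=q^n h_n-q^{n-1}\Big(\tfrac12 h_{n-1}+\tfrac34 h_{n-2}\Big)+q^{n-2}\Big(\tfrac58 h_{n-2}+\tfrac38 h_{n-3}-\tfrac3{32}h_{n-4}\Big)-q^{n-3}\Big(\tfrac7{16}h_{n-3}+\tfrac{11}{32}h_{n-4}-\tfrac3{64}h_{n-5}+\tfrac5{128}h_{n-6}\Big)+O(q^{n-4})$$ and $$B_q(n)=q^n h_n+q^{n-1}\Big(\tfrac12 h_{n-1}+\tfrac14 h_{n-2}\Big)+q^{n-2}\Big(\tfrac18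 h_{n-2}+\tfrac18 h_{n-3}+\tfrac5{32}h_{n-4}\Big)+q^{n-3}\Big(\tfrac3{16}h_{n-3}+\tfrac5{32}h_{n-4}+\tfrac5{64}h_{n-5}+\tfrac{15}{128}h_{n-6}\Big)+O(q^{n-4}),$$ where the implied constants are absolute (independent of both $q$ and $n$). -/

import Mathlib

open Polynomial

namespace NormCount

/-- The set of monic polynomials of degree `n` over `F`. -/
def monicPolys (F : Type*) [Field F] (n : ℕ) : Set F[X] :=
  {f | f.Monic ∧ f.natDegree = n}

/-- `f = A ^ 2 + T * B ^ 2` for some polynomials `A`, `B`. -/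
def IsPlusForm {F : Type*} [Field F] (f : F[X]) : Prop :=
  ∃ A B : F[X], f = A ^ 2 + X * B ^ 2

/-- `f = A ^ 2 - T * B ^ 2` for some polynomials `A`, `B`, i.e. `f` is a norm from `F[√T]`. -/
def IsMinusForm {F : Type*} [Field F] (f : F[X]) : Prop :=
  ∃ A B : F[X], f = A ^ 2 - X * B ^ 2

/-- The number of monic `f` of degree `n` of the form `A ^ 2 + T * B ^ 2`. -/
noncomputable def countB (F : Type*) [Field F] (n : ℕ) : ℕ :=
  {f ∈ monicPolys F n | IsPlusForm f}.ncard

/-- The number of monic squarefree `f` of degree `n` with `f(0) ≠ 0` such that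
`(-1) ^ n * f` is of the form `A ^ 2 - T * B ^ 2`. The sign is forced by leading coefficients:
for `n` odd, `A ^ 2 - T * B ^ 2` of degree `n` has leading coefficient minus a square. -/
noncomputable def countS (F : Type*) [Field F] (n : ℕ) : ℕ :=
  {f ∈ monicPolys F n | Squarefree f ∧ f.eval 0 ≠ 0 ∧ IsMinusForm ((-1) ^ n * f)}.ncard

/-- The same count without the sign: the number of monic squarefree `f` of degree `n` with
`f(0) ≠ 0` of the form `A ^ 2 - T * B ^ 2`. -/
noncomputable def countSUnsigned (F : Type*) [Field F] (n : ℕ) : ℕ :=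
  {f ∈ monicPolys F n | Squarefree f ∧ f.eval 0 ≠ 0 ∧ IsMinusForm f}.ncard

/-- `h k = C(2k, k) / 4 ^ k` for `k ≥ 0`, and `h k = 0` for `k < 0`. -/
noncomputable def h (k : ℤ) : ℝ :=
  if 0 ≤ k then ((2 * k.toNat).choose k.toNat : ℝ) / 4 ^ k.toNat else 0

/-- The explicit main terms of the squarefree count. -/
noncomputable def mainS (q : ℝ) (n : ℤ) : ℝ :=
  q ^ n * h n
    - q ^ (n - 1) * (1 / 2 * h (n - 1) + 3 / 4 * h (n - 2))
    + q ^ (n - 2) * (5 / 8 * h (n - 2) + 3 / 8 * h (n - 3) - 3 / 32 * h (n - 4))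
    - q ^ (n - 3) * (7 / 16 * h (n - 3) + 11 / 32 * h (n - 4) - 3 / 64 * h (n - 5)
        + 5 / 128 * h (n - 6))

/-- The explicit main terms of the full count. -/
noncomputable def mainB (q : ℝ) (n : ℤ) : ℝ :=
  q ^ n * h n
    + q ^ (n - 1) * (1 / 2 * h (n - 1) + 1 / 4 * h (n - 2))
    + q ^ (n - 2) * (1 / 8 * h (n - 2) + 1 / 8 * h (n - 3) + 5 / 32 * h (n - 4))
    + q ^ (n - 3) * (3 / 16 * h (n - 3) + 5 / 32 * h (n - 4) + 5 / 64 * h (n - 5)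
        + 15 / 128 * h (n - 6))

/-- Over a finite field the counts above are counts of finite sets. -/
theorem finite_monicPolys (F : Type*) [Field F] [Finite F] (n : ℕ) :
    (monicPolys F n).Finite := by
  have h1 : (Polynomial.degreeLT F (n + 1) : Set F[X]).Finite := by
    have : Finite (Polynomial.degreeLT F (n + 1)) :=
      Finite.of_equiv _ (Polynomial.degreeLTEquiv F (n + 1)).toEquiv.symm
    exact Set.toFinite _
  refine h1.subset ?_
  rintro f ⟨hm, hd⟩
  rw [SetLike.mem_coe, Polynomial.mem_degreeLT, Polynomial.degree_eq_natDegree hm.ne_zero, hd]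
  exact_mod_cast Nat.lt_succ_self n

end NormCount

/-!
Let `q = |F|`, and let `D(u) = ∑ B(n) u ^ n` be the generating function of the monic polynomials of
the form `A ^ 2 + T * B ^ 2`, the norms from `F[√(-T)]`. A prime `P` of `F[T]` is ramified, split or
inert in this ring according to the quadratic character `η(P(0))` being `0`, `1` or `-1`: the
element `-T` of the finite field `F[T] / P` has norm `P(0)`, so it is a square there exactly if
`P(0)` is one, and in that case a dimension count writes `P` as `A ^ 2 + T * B ^ 2`
(`isSquare_eval_zero_of_dvd`, `isPlusForm_of_eval_zero`). Hence a monic `f` has the required form if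
and only if every inert prime divides it to an even power (`isPlusForm_ofExp_iff`). After the
substitution `f(T) ↦ (-1) ^ n f(-T)`, the squarefree polynomials counted by `countS` are the
squarefree products of split primes (`countS_eq`).

All generating functions therefore have Euler products whose factor at `P` depends on `η(P(0))` only
(`hasProd_expand`). So has the `L`-function of `f ↦ η(f(0))`, which is identically `1`
(`sum_quadraticChar_eval`). Comparing factors gives the functional equations
`(1 - q u) D(u) ^ 2 = (1 + u) D(u ^ 2)` and `(1 - q u ^ 2) D(u) = (1 + u) S(u)`
(`genB_functional`, `genS_functional`), `S` being the generating function of `countS`.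

Put `x = 1 / q` and rescale `u` by `x`. The first equation says that `D(x u) = (1 - u) ^ (-1 / 2) K`
with `K ^ 2 = (1 + x u) M(u ^ 2)`, where `M` has coefficients `x ^ n b n` with `0 ≤ b n ≤ 1`. Taking
the square root modulo `x ^ 4` gives an explicit polynomial `P` in `x` and `u`, and the sum of the
absolute values of the coefficients of `K - P` is `O(x ^ 4)` uniformly in `q`
(`exists_coeffNorm_sub_mainPolyB_le`). As the coefficients `h k` of `(1 - u) ^ (-1 / 2)` lie in
`[0, 1]`, the coefficients of `(K - P) (1 - u) ^ (-1 / 2)` are `O(x ^ 4)`, and those of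
`P (1 - u) ^ (-1 / 2)` are the main terms. The squarefree count follows from the second equation.
-/

namespace NormCount

/-! ### The quadratic forms -/

section Forms
variable {F : Type*} [Field F]

theorem IsPlusForm.mul {f g : F[X]} (hf : IsPlusForm f) (hg : IsPlusForm g) :
    IsPlusForm (f * g) := by
  obtain ⟨A, B, rfl⟩ := hf
  obtain ⟨C, D, rfl⟩ := hg
  exact ⟨A * C - X * B * D, A * D + B * C, by ring⟩

theorem isPlusForm_sq (f : F[X]) : IsPlusForm (f ^ 2) := ⟨f, 0, by ring⟩

theorem isPlusForm_one : IsPlusForm (1 : F[X]) := ⟨1, 0, by ring⟩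

theorem isPlusForm_X : IsPlusForm (X : F[X]) := ⟨0, 1, by ring⟩

theorem IsPlusForm.pow {f : F[X]} (hf : IsPlusForm f) (k : ℕ) : IsPlusForm (f ^ k) := by
  induction k with
  | zero => simpa using isPlusForm_one
  | succ k ih => rw [pow_succ]; exact ih.mul hf

/-- Substituting `-T` for `T` turns the form `A ^ 2 - T * B ^ 2` into `A ^ 2 + T * B ^ 2`. -/
theorem isMinusForm_comp_neg_X {f : F[X]} : IsMinusForm (f.comp (-X)) ↔ IsPlusForm f := by
  constructor
  · rintro ⟨A, B, h⟩
    refine ⟨A.comp (-X), B.comp (-X), ?_⟩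
    rw [← comp_neg_X_comp_neg_X f, h]
    simp
  · rintro ⟨A, B, rfl⟩
    exact ⟨A.comp (-X), B.comp (-X), by simp [sub_eq_add_neg]⟩

theorem isMinusForm_neg_iff (h : IsSquare (-1 : F)) {f : F[X]} :
    IsMinusForm (-f) ↔ IsMinusForm f := by
  obtain ⟨i, hi⟩ := h
  have hC : (C i : F[X]) ^ 2 = -1 := by
    rw [← C_pow, sq, ← hi]; simp
  have key : ∀ g : F[X], IsMinusForm g → IsMinusForm (-g) := by
    rintro g ⟨A, B, rfl⟩
    exact ⟨C i * A, C i * B, by linear_combination (A ^ 2 - X * B ^ 2) * (-hC)⟩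
  exact ⟨fun h => by simpa using key _ h, key f⟩

end Forms

/-! ### Primes represented by the form -/

section Reciprocity
variable {F : Type*} [Field F]

/-- In `K = F[T] / P` the element `-T` has norm `P(0)`. -/
theorem norm_neg_root {P : F[X]} (hm : P.Monic) (hirr : Irreducible P) :
    Algebra.norm F (-AdjoinRoot.root P) = P.eval 0 := by
  let := Fact.mk hirr
  have h1 := Algebra.PowerBasis.norm_gen_eq_coeff_zero_minpoly (AdjoinRoot.powerBasis hm.ne_zero)
  have hd : Module.finrank F (AdjoinRoot P) = P.natDegree := by
    rw [(AdjoinRoot.powerBasis hm.ne_zero).finrank, AdjoinRoot.powerBasis_dim]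
  have hn : Algebra.norm F (-1 : AdjoinRoot P) = (-1) ^ P.natDegree := by
    have := Algebra.norm_algebraMap (S := AdjoinRoot P) (-1 : F)
    rwa [hd, map_neg, map_one] at this
  rw [AdjoinRoot.minpoly_powerBasis_gen_of_monic hm, AdjoinRoot.powerBasis_gen,
    AdjoinRoot.powerBasis_dim] at h1
  rw [← neg_one_mul, map_mul, hn, h1, ← mul_assoc, ← mul_pow]
  simp [coeff_zero_eq_eval_zero]

theorem finite_adjoinRoot [Finite F] {P : F[X]} (hm : P.Monic) : Finite (AdjoinRoot P) :=
  have := (AdjoinRoot.powerBasis hm.ne_zero).finite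
  Module.finite_of_finite F

/-- The easy half of the reciprocity law: if `-T` is a square modulo `P`, then `P(0)` is a square,
being the norm of `-T`. -/
theorem isSquare_eval_zero_of_dvd {P A B : F[X]} (hm : P.Monic) (hirr : Irreducible P)
    (hB : ¬ P ∣ B) (h : P ∣ A ^ 2 + X * B ^ 2) : IsSquare (P.eval 0) := by
  let := Fact.mk hirr
  have hb : AdjoinRoot.mk P B ≠ 0 := by rwa [Ne, AdjoinRoot.mk_eq_zero]
  have h2 : AdjoinRoot.mk P A ^ 2 + AdjoinRoot.root P * AdjoinRoot.mk P B ^ 2 = 0 := by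
    have := AdjoinRoot.mk_eq_zero.2 h
    simpa using this
  have h3 : -AdjoinRoot.root P = (AdjoinRoot.mk P A / AdjoinRoot.mk P B) ^ 2 := by
    rw [div_pow, eq_div_iff (pow_ne_zero 2 hb)]
    linear_combination -h2
  rw [← norm_neg_root hm hirr, h3, map_pow]
  exact IsSquare.sq _

/-- The other half of the reciprocity law: if `P(0)` is a nonzero square, then `-T` is a square
modulo `P`, by Euler's criterion in `F[T] / P` and the formula for the norm of finite fields. -/
theorem isSquare_neg_root [Fintype F] {P : F[X]} (hF : Odd (Fintype.card F)) (hm : P.Monic)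
    (hirr : Irreducible P) {r : F} (hr : r ≠ 0) (h : P.eval 0 = r ^ 2) :
    IsSquare (-AdjoinRoot.root P) := by
  let := Fact.mk hirr
  have := finite_adjoinRoot hm
  let := Fintype.ofFinite (AdjoinRoot P)
  have hcard : Fintype.card (AdjoinRoot P) =
      Fintype.card F ^ Module.finrank F (AdjoinRoot P) := Module.card_eq_pow_finrank
  set q := Fintype.card F with hq
  set Q := Fintype.card (AdjoinRoot P) with hQ
  have hQodd : Odd Q := hcard ▸ hF.pow
  have hchar : ringChar (AdjoinRoot P) ≠ 2 := by
    intro h2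
    have := FiniteField.even_card_iff_char_two.1 h2
    have := Nat.odd_iff.1 hQodd
    omega
  have hnorm : Algebra.norm F (-AdjoinRoot.root P) = r ^ 2 := by
    rw [norm_neg_root hm hirr, h]
  have h0 : -AdjoinRoot.root P ≠ 0 := by
    intro h0
    have := (AdjoinRoot.powerBasis hm.ne_zero).finite
    rw [h0, Algebra.norm_zero] at hnorm
    exact pow_ne_zero 2 hr hnorm.symm
  rw [FiniteField.isSquare_iff hchar h0]
  have h1 := FiniteField.algebraMap_norm_eq_pow (K := F) (x := -AdjoinRoot.root P)
  rw [hnorm, Nat.card_eq_fintype_card, Nat.card_eq_fintype_card] at h1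
  have hdvd : q - 1 ∣ Q - 1 := by rw [hcard]; exact Nat.sub_one_dvd_pow_sub_one _ _
  obtain ⟨m, hm'⟩ := hdvd
  have hq1 : 1 < q := Fintype.one_lt_card
  obtain ⟨k, hk⟩ := hF
  have hk0 : 0 < k := by omega
  have e1 : (Q - 1) / (q - 1) = m := by rw [hm']; exact Nat.mul_div_cancel_left _ (by omega)
  have e2 : Q / 2 = m * k := by
    have : Q - 1 = 2 * (m * k) := by rw [hm', hk]; simp; ring
    obtain ⟨j, hj⟩ := hQodd
    omega
  rw [e1] at h1
  rw [← hQ, e2, pow_mul, ← h1, ← map_pow, ← pow_mul]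
  have : r ^ (2 * k) = 1 := by
    have := FiniteField.pow_card_sub_one_eq_one r hr
    rwa [← hq, hk, Nat.add_sub_cancel] at this
  rw [this, map_one]

/-- A monic irreducible `P` with `P(0)` a nonzero square is of the form `A ^ 2 + T * B ^ 2`.
With `γ ^ 2 = -T` in `F[T] / P`, a dimension count gives a nonzero pair `(A, B)` with
`A = γ * B` in `F[T] / P` and `deg (A ^ 2 + T * B ^ 2) ≤ deg P`, so that `A ^ 2 + T * B ^ 2` is a
constant multiple of `P`. -/
theorem isPlusForm_of_eval_zero [Fintype F] {P : F[X]} (hF : Odd (Fintype.card F)) (hm : P.Monic)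
    (hirr : Irreducible P) {r : F} (hr : r ≠ 0) (h : P.eval 0 = r ^ 2) : IsPlusForm P := by
  let := Fact.mk hirr
  obtain ⟨γ, hγ⟩ := isSquare_neg_root hF hm hirr hr h
  set d := P.natDegree with hd
  have hfin : Module.finrank F (AdjoinRoot P) = d := by
    rw [(AdjoinRoot.powerBasis hm.ne_zero).finrank, AdjoinRoot.powerBasis_dim]
  have := (AdjoinRoot.powerBasis hm.ne_zero).finite
  -- bounds on the numbers of coefficients: `2 * deg A ≤ d` and `2 * deg B + 1 ≤ d`
  let φ : degreeLT F (d / 2 + 1) × degreeLT F ((d + 1) / 2) →ₗ[F] AdjoinRoot P :=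
    ((AdjoinRoot.mkₐ P).toLinearMap.comp (degreeLT F (d / 2 + 1)).subtype).coprod
      (-(LinearMap.mulLeft F γ).comp
        ((AdjoinRoot.mkₐ P).toLinearMap.comp (degreeLT F ((d + 1) / 2)).subtype))
  have hdim : ∀ n, Module.finrank F (degreeLT F n) = n := fun n => by
    rw [(degreeLTEquiv F n).finrank_eq, Module.finrank_fin_fun]
  have : ∀ n, Module.Finite F (degreeLT F n) := fun n =>
    Module.Finite.equiv (degreeLTEquiv F n).symm
  have hker : LinearMap.ker φ ≠ ⊥ := by
    apply LinearMap.ker_ne_bot_of_finrank_lt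
    rw [Module.finrank_prod, hdim, hdim, hfin]
    omega
  obtain ⟨⟨⟨A, hA⟩, ⟨B, hB⟩⟩, hmem, hne⟩ := (Submodule.ne_bot_iff _).1 hker
  have hAB : AdjoinRoot.mk P A = γ * AdjoinRoot.mk P B := by
    have : AdjoinRoot.mk P A - γ * AdjoinRoot.mk P B = 0 := by
      simpa [φ, sub_eq_add_neg] using hmem
    exact sub_eq_zero.1 this
  have hdvd : P ∣ A ^ 2 + X * B ^ 2 := by
    rw [← AdjoinRoot.mk_eq_zero]
    simp only [map_add, map_mul, map_pow, AdjoinRoot.mk_X, hAB]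
    linear_combination (-(AdjoinRoot.mk P B) ^ 2) * hγ
  have hnat : ∀ (n : ℕ) (f : F[X]), f ∈ degreeLT F n → 0 < n → f.natDegree < n := by
    intro n f hf hn
    by_cases h0 : f = 0
    · simpa [h0] using hn
    · rwa [natDegree_lt_iff_degree_lt h0, ← mem_degreeLT]
  have hdpos : 0 < d := hirr.natDegree_pos
  have hAd := hnat _ _ hA (by omega)
  have hBd := hnat _ _ hB (by omega)
  have hA2 : (A ^ 2).natDegree ≤ d := natDegree_pow_le.trans (by omega)
  have hB2 : (X * B ^ 2).natDegree ≤ d := by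
    refine natDegree_mul_le.trans ?_
    have := natDegree_pow_le (p := B) (n := 2)
    simp only [natDegree_X]
    omega
  have hle : (A ^ 2 + X * B ^ 2).natDegree ≤ d := (natDegree_add_le _ _).trans (max_le hA2 hB2)
  have hne0 : A ^ 2 + X * B ^ 2 ≠ 0 := by
    intro h0
    by_cases hB0 : B = 0
    · have hA0 : A = 0 := by simpa [hB0] using h0
      exact hne (by ext <;> simp [hA0, hB0])
    · have h1 : A ^ 2 = -(X * B ^ 2) := eq_neg_of_add_eq_zero_left h0
      have h2 := congrArg natDegree h1
      rw [natDegree_neg, natDegree_X_mul (pow_ne_zero 2 hB0), natDegree_pow, natDegree_pow] at h2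
      omega
  obtain ⟨Q, hQ⟩ := hdvd
  have hQ0 : Q ≠ 0 := by rintro rfl; exact hne0 (by simpa using hQ)
  have hQd : Q.natDegree = 0 := by
    have := congrArg natDegree hQ
    rw [natDegree_mul hm.ne_zero hQ0] at this
    omega
  obtain ⟨c, rfl⟩ := natDegree_eq_zero.1 hQd
  have hc : c ≠ 0 := by rintro rfl; simp at hQ0
  -- evaluating at `0` shows that the constant is a square
  have hev : (A.eval 0) ^ 2 = r ^ 2 * c := by
    have := congrArg (eval 0) hQ
    simpa [h] using this
  have ha : A.eval 0 ≠ 0 := by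
    intro ha
    rw [ha] at hev
    exact mul_ne_zero (pow_ne_zero 2 hr) hc (by simpa using hev.symm)
  refine ⟨C (r / A.eval 0) * A, C (r / A.eval 0) * B, ?_⟩
  have hs : (C (r / A.eval 0) : F[X]) ^ 2 * C c = 1 := by
    rw [← C_pow, ← C_mul, ← C_1]
    congr 1
    field_simp
    linear_combination -hev
  linear_combination (-(C (r / A.eval 0)) ^ 2) * hQ - P * hs

/-- A prime `P` with `P(0)` a non-square divides a polynomial of the form `A ^ 2 + T * B ^ 2` to
an even power. -/
theorem even_of_sq_add_eq_pow_mul {P : F[X]} (hm : P.Monic) (hirr : Irreducible P)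
    (hns : ¬ IsSquare (P.eval 0)) (k : ℕ) :
    ∀ A B g : F[X], A ^ 2 + X * B ^ 2 = P ^ k * g → ¬ P ∣ g → Even k := by
  have hp : Prime P := hirr.prime
  induction k using Nat.strong_induction_on with
  | _ k ih =>
    intro A B g h hg
    obtain rfl | hk := Nat.eq_zero_or_pos k
    · exact Even.zero
    have hdvd : P ∣ A ^ 2 + X * B ^ 2 := h ▸ (dvd_pow_self P hk.ne').mul_right g
    have hB : P ∣ B := by
      by_contra hB
      exact hns (isSquare_eval_zero_of_dvd hm hirr hB hdvd)
    have hA : P ∣ A := by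
      refine hp.dvd_of_dvd_pow (n := 2) ((dvd_add_left ?_).1 hdvd)
      exact (dvd_pow hB two_ne_zero).mul_left X
    obtain ⟨A', rfl⟩ := hA
    obtain ⟨B', rfl⟩ := hB
    have h2 : P ^ 2 * (A' ^ 2 + X * B' ^ 2) = P ^ k * g := by rw [← h]; ring
    match k, hk, ih, h2 with
    | 1, _, _, h2 =>
      refine absurd ?_ hg
      refine ⟨A' ^ 2 + X * B' ^ 2, mul_left_cancel₀ hp.ne_zero ?_⟩
      linear_combination -h2
    | k + 2, _, ih, h2 =>
      have h3 : A' ^ 2 + X * B' ^ 2 = P ^ k * g := by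
        refine mul_left_cancel₀ (pow_ne_zero 2 hp.ne_zero) ?_
        rw [h2]; ring
      have := ih k (by omega) A' B' g h3 hg
      exact this.add even_two

end Reciprocity

/-! ### Euler products over exponent vectors -/

section Euler
open Finset
open scoped PowerSeries PowerSeries.WithPiTopology

variable {ι : Type*} (d : ι → ℕ)

/-- The `d`-weighted degree of an exponent vector. -/
def wt (e : ι →₀ ℕ) : ℕ := e.sum fun i k => k * d i

variable {d}

theorem wt_eq_sum {s : Finset ι} {e : ι →₀ ℕ} (h : e.support ⊆ s) :
    wt d e = ∑ i ∈ s, e i * d i :=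
  Finsupp.sum_of_support_subset e h _ (by simp)

theorem le_wt {e : ι →₀ ℕ} {i : ι} (h : e i ≠ 0) : d i ≤ wt d e := by
  have h1 : e i * d i ≤ wt d e :=
    Finset.single_le_sum (f := fun i => e i * d i) (fun _ _ => Nat.zero_le _)
      (Finsupp.mem_support_iff.2 h)
  exact (Nat.le_mul_of_pos_left _ (Nat.pos_of_ne_zero h)).trans h1

/-- The coefficient of `u ^ n` in a finite Euler product, as soon as the product contains all
factors whose weight is at most `n`. -/
theorem coeff_prod_expand (hd : ∀ i, d i ≠ 0) {n : ℕ} {s : Finset ι} (hs : ∀ i, d i ≤ n → i ∈ s)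
    {T : Finset (ι →₀ ℕ)} (hT : ∀ e, e ∈ T ↔ wt d e = n) {c : ι → ℕ → ℝ} (hc : ∀ i, c i 0 = 1) :
    PowerSeries.coeff n (∏ i ∈ s, PowerSeries.expand (d i) (hd i) (PowerSeries.mk (c i))) =
      ∑ e ∈ T, e.prod c := by
  classical
  have hsupp : ∀ e ∈ T, e.support ⊆ s := fun e he i hi =>
    hs i ((le_wt (Finsupp.mem_support_iff.1 hi)).trans ((hT e).1 he).le)
  let σ : (ι →₀ ℕ) → (ι →₀ ℕ) := fun e =>
    Finsupp.onFinset e.support (fun i => d i * e i) fun i hi =>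
      Finsupp.mem_support_iff.2 (right_ne_zero_of_mul hi)
  rw [PowerSeries.coeff_prod]
  symm
  refine Finset.sum_of_injOn σ ?_ ?_ ?_ ?_
  · intro e _ e' _ h
    ext i
    have := DFunLike.congr_fun h i
    exact Nat.eq_of_mul_eq_mul_left (Nat.pos_of_ne_zero (hd i)) this
  · intro e he
    rw [Finset.mem_coe, mem_finsuppAntidiag]
    refine ⟨?_, (Finsupp.support_onFinset_subset).trans (hsupp e he)⟩
    rw [← (hT e).1 he, wt_eq_sum (hsupp e he)]
    exact Finset.sum_congr rfl fun i _ => mul_comm _ _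
  · intro l hl hl'
    rw [mem_finsuppAntidiag] at hl
    by_contra hne
    have hdvd : ∀ i ∈ s, d i ∣ l i := by
      intro i hi
      by_contra hni
      exact hne (Finset.prod_eq_zero hi (PowerSeries.coeff_expand_of_not_dvd _ _ _ hni))
    have hdvd' : ∀ i, d i * (l i / d i) = l i := by
      intro i
      by_cases hi : i ∈ s
      · exact Nat.mul_div_cancel' (hdvd i hi)
      · have : l i = 0 := by
          by_contra h
          exact hi (hl.2 (Finsupp.mem_support_iff.2 h))
        simp [this]
    refine hl' ⟨Finsupp.onFinset l.support (fun i => l i / d i) fun i hi =>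
      Finsupp.mem_support_iff.2 fun h => hi (by simp [h]), ?_, ?_⟩
    · rw [Finset.mem_coe, hT, wt_eq_sum (s := s) (Finsupp.support_onFinset_subset.trans hl.2),
        ← hl.1]
      exact Finset.sum_congr rfl fun i _ => by
        rw [Finsupp.onFinset_apply, mul_comm, hdvd']
    · ext i
      exact hdvd' i
  · intro e he
    rw [Finsupp.prod_of_support_subset e (hsupp e he) c fun i _ => hc i]
    refine Finset.prod_congr rfl fun i _ => ?_
    change _ = PowerSeries.coeff (d i * e i) _
    rw [PowerSeries.coeff_expand_mul, PowerSeries.coeff_mk]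

/-- The Euler product for a weight `e ↦ ∏ c i (e i)` on exponent vectors, in the topology of
coefficientwise convergence. -/
theorem hasProd_expand (hd : ∀ i, d i ≠ 0) (hfin : ∀ n, {i | d i ≤ n}.Finite)
    {T : ℕ → Finset (ι →₀ ℕ)} (hT : ∀ n e, e ∈ T n ↔ wt d e = n) {c : ι → ℕ → ℝ}
    (hc : ∀ i, c i 0 = 1) :
    HasProd (fun i => PowerSeries.expand (d i) (hd i) (PowerSeries.mk (c i)))
      (PowerSeries.mk fun n => ∑ e ∈ T n, e.prod c) := by
  rw [HasProd, PowerSeries.WithPiTopology.tendsto_iff_coeff_tendsto]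
  intro n
  refine tendsto_const_nhds.congr' ?_
  rw [SummationFilter.unconditional_filter]
  filter_upwards [Filter.eventually_ge_atTop (hfin n).toFinset] with s hs
  rw [PowerSeries.coeff_mk, coeff_prod_expand hd (fun i hi => hs (by simpa using hi)) (hT n) hc]

theorem continuous_expand (p : ℕ) (hp : p ≠ 0) :
    Continuous (PowerSeries.expand p hp : ℝ⟦X⟧ → ℝ⟦X⟧) := by
  rw [continuous_iff_continuousAt]
  intro f
  rw [ContinuousAt, PowerSeries.WithPiTopology.tendsto_iff_coeff_tendsto]
  intro n
  simp only [PowerSeries.coeff_expand]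
  split_ifs
  · exact (PowerSeries.WithPiTopology.continuous_coeff ℝ _).continuousAt
  · exact tendsto_const_nhds

end Euler

/-! ### Unique factorization of monic polynomials -/

section Factorization
variable {F : Type*} [Field F]

/-- The monic irreducible polynomials, i.e. the primes of `F[T]`. -/
abbrev MonicPrime (F : Type*) [Field F] : Type _ := {P : F[X] // P.Monic ∧ Irreducible P}

/-- The monic polynomial with a given exponent vector. -/
noncomputable def ofExp (e : MonicPrime F →₀ ℕ) : F[X] := e.prod fun P k => P.1 ^ k

/-- The degrees of the primes. -/
noncomputable def primeDeg (P : MonicPrime F) : ℕ := P.1.natDegree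

theorem primeDeg_ne_zero (P : MonicPrime F) : primeDeg P ≠ 0 := P.2.2.natDegree_pos.ne'

theorem monic_ofExp (e : MonicPrime F →₀ ℕ) : (ofExp e).Monic :=
  monic_prod_of_monic _ _ fun P _ => P.2.1.pow _

theorem natDegree_ofExp (e : MonicPrime F →₀ ℕ) : (ofExp e).natDegree = wt primeDeg e := by
  rw [ofExp, Finsupp.prod, natDegree_prod_of_monic _ _ fun P _ => P.2.1.pow _]
  exact Finset.sum_congr rfl fun P _ => P.2.1.natDegree_pow _

theorem ofExp_zero : ofExp (0 : MonicPrime F →₀ ℕ) = 1 := Finsupp.prod_zero_index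

theorem ofExp_add (e e' : MonicPrime F →₀ ℕ) : ofExp (e + e') = ofExp e * ofExp e' := by
  classical
  exact Finsupp.prod_add_index' (fun _ => pow_zero _) fun _ _ _ => pow_add _ _ _

theorem ofExp_single (P : MonicPrime F) (k : ℕ) : ofExp (Finsupp.single P k) = P.1 ^ k :=
  Finsupp.prod_single_index (pow_zero _)

theorem ofExp_eq_pow_mul (e : MonicPrime F →₀ ℕ) (P : MonicPrime F) :
    ofExp e = P.1 ^ e P * ofExp (e.erase P) := by
  rw [← ofExp_single, ← ofExp_add, Finsupp.single_add_erase]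

theorem not_dvd_ofExp_erase (e : MonicPrime F →₀ ℕ) (P : MonicPrime F) :
    ¬ P.1 ∣ ofExp (e.erase P) := by
  intro h
  obtain ⟨Q, hQ, hdvd⟩ := (P.2.2.prime.dvd_finsetProd_iff _).1 h
  have h1 := P.2.2.prime.dvd_of_dvd_pow hdvd
  have h2 : P.1 = Q.1 :=
    eq_of_monic_of_associated P.2.1 Q.2.1 (P.2.2.associated_of_dvd Q.2.2 h1)
  rw [Subtype.ext h2] at hQ
  simp at hQ

theorem pow_dvd_ofExp_iff (e : MonicPrime F →₀ ℕ) (P : MonicPrime F) (k : ℕ) :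
    P.1 ^ k ∣ ofExp e ↔ k ≤ e P := by
  constructor
  · intro h
    by_contra! hlt
    rw [ofExp_eq_pow_mul e P] at h
    have h1 : P.1 ^ (e P) * P.1 ∣ P.1 ^ e P * ofExp (e.erase P) := by
      rw [← pow_succ]
      exact (pow_dvd_pow _ hlt).trans h
    exact not_dvd_ofExp_erase e P ((mul_dvd_mul_iff_left (pow_ne_zero _ P.2.2.ne_zero)).1 h1)
  · intro h
    rw [ofExp_eq_pow_mul e P]
    exact (pow_dvd_pow _ h).mul_right _

theorem ofExp_injective : Function.Injective (ofExp (F := F)) := by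
  intro e e' h
  ext P
  apply le_antisymm
  · rw [← pow_dvd_ofExp_iff, ← h, pow_dvd_ofExp_iff]
  · rw [← pow_dvd_ofExp_iff, h, pow_dvd_ofExp_iff]

theorem exists_ofExp_eq {f : F[X]} (hf : f.Monic) : ∃ e, ofExp e = f := by
  induction hn : f.natDegree using Nat.strong_induction_on generalizing f with
  | _ n ih =>
    by_cases hu : IsUnit f
    · exact ⟨0, by rw [ofExp_zero, hf.eq_one_of_isUnit hu]⟩
    · obtain ⟨P, hm, hirr, g, rfl⟩ := exists_monic_irreducible_factor f hu
      have hg : g.Monic := hm.of_mul_monic_left hf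
      have hlt : g.natDegree < n := by
        rw [hm.natDegree_mul hg] at hn
        have := hirr.natDegree_pos
        omega
      obtain ⟨e, rfl⟩ := ih _ hlt hg rfl
      exact ⟨Finsupp.single ⟨P, hm, hirr⟩ 1 + e, by rw [ofExp_add, ofExp_single, pow_one]⟩

theorem squarefree_ofExp_iff (e : MonicPrime F →₀ ℕ) :
    Squarefree (ofExp e) ↔ ∀ P, e P ≤ 1 := by
  rw [squarefree_iff_irreducible_sq_not_dvd_of_ne_zero (monic_ofExp e).ne_zero]
  constructor
  · intro h P
    by_contra! hlt
    exact h P.1 P.2.2 (by rw [← sq, pow_dvd_ofExp_iff]; exact hlt)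
  · intro h x hx hdvd
    obtain ⟨P, hm, hirr, hPx⟩ := exists_monic_irreducible_factor x hx.not_isUnit
    have h1 : P ^ 2 ∣ ofExp e := by
      rw [sq]; exact (mul_dvd_mul hPx hPx).trans hdvd
    have := (pow_dvd_ofExp_iff e ⟨P, hm, hirr⟩ 2).1 h1
    have := h ⟨P, hm, hirr⟩
    omega

section Finite
variable [Fintype F]

theorem finite_primeDeg_le (n : ℕ) : {P : MonicPrime F | primeDeg P ≤ n}.Finite := by
  have h : (⋃ k ∈ Set.Iic n, monicPolys F k).Finite :=
    (Set.finite_Iic n).biUnion fun k _ => finite_monicPolys F k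
  refine (h.preimage Subtype.val_injective.injOn).subset fun P hP => ?_
  exact Set.mem_biUnion (x := P.1.natDegree) hP ⟨P.2.1, rfl⟩

theorem finite_wt_eq (n : ℕ) : {e : MonicPrime F →₀ ℕ | wt primeDeg e = n}.Finite :=
  ((finite_monicPolys F n).preimage ofExp_injective.injOn).subset fun e he =>
    ⟨monic_ofExp e, (natDegree_ofExp e).trans he⟩

theorem sum_wt_eq_sum_monic (n : ℕ) (g : F[X] → ℝ) :
    ∑ e ∈ (finite_wt_eq (F := F) n).toFinset, g (ofExp e) =
      ∑ f ∈ (finite_monicPolys F n).toFinset, g f := by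
  refine Finset.sum_bij (fun e _ => ofExp e) ?_ (fun _ _ _ _ h => ofExp_injective h) ?_
    (fun _ _ => rfl)
  · intro e he
    rw [Set.Finite.mem_toFinset] at he ⊢
    exact ⟨monic_ofExp e, (natDegree_ofExp e).trans he⟩
  · intro f hf
    rw [Set.Finite.mem_toFinset] at hf
    obtain ⟨e, rfl⟩ := exists_ofExp_eq hf.1
    refine ⟨e, ?_, rfl⟩
    rw [Set.Finite.mem_toFinset]
    exact (natDegree_ofExp e).symm.trans hf.2

open scoped PowerSeries PowerSeries.WithPiTopology in
/-- The Euler product of the generating function of a function `g` on monic polynomials that is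
given by local weights. -/
theorem hasProd_genFun {c : MonicPrime F → ℕ → ℝ} (hc : ∀ P, c P 0 = 1) {g : F[X] → ℝ}
    (hg : ∀ e, g (ofExp e) = e.prod c) :
    HasProd (fun P => PowerSeries.expand (primeDeg P) (primeDeg_ne_zero P) (PowerSeries.mk (c P)))
      (PowerSeries.mk fun n => ∑ f ∈ (finite_monicPolys F n).toFinset, g f) := by
  have := hasProd_expand primeDeg_ne_zero finite_primeDeg_le
    (T := fun n => (finite_wt_eq (F := F) n).toFinset) (fun n e => by simp) hc
  convert this using 3 with n
  rw [← sum_wt_eq_sum_monic]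
  exact Finset.sum_congr rfl fun e _ => hg e

theorem ncard_eq_sum (n : ℕ) (Q : F[X] → Prop) [DecidablePred Q] :
    (({f ∈ monicPolys F n | Q f}.ncard : ℕ) : ℝ) =
      ∑ f ∈ (finite_monicPolys F n).toFinset, if Q f then 1 else 0 := by
  rw [Finset.sum_boole, ← Set.ncard_coe_finset]
  congr 2
  ext f
  simp

theorem ncard_monicPolys (n : ℕ) : (monicPolys F n).ncard = Fintype.card F ^ n := by
  rw [← Nat.card_coe_set_eq]
  have e : (monicPolys F n : Set F[X]) ≃ (Fin n → F) :=
    (monicEquivDegreeLT n).trans (degreeLTEquiv F n).toEquiv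
  rw [Nat.card_congr e, Nat.card_fun]
  simp

end Finite
end Factorization

/-! ### Local description of the forms -/

section Local
variable {F : Type*} [Field F] [Fintype F]

open scoped Classical in
/-- The quadratic character of `P(0)`, for a prime `P`. It tells whether `P` ramifies (`0`), splits
(`1`) or is inert (`-1`) in `F[√(-T)]`. -/
noncomputable def primeSign (P : MonicPrime F) : ℤ := quadraticChar F (P.1.eval 0)

theorem primeSign_cases (P : MonicPrime F) :
    primeSign P = 0 ∨ primeSign P = 1 ∨ primeSign P = -1 := by
  classical
  by_cases h : P.1.eval 0 = 0
  · exact Or.inl (by rw [primeSign]; convert quadraticChar_eq_zero_iff.2 h)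
  · exact Or.inr (by rw [primeSign]; convert quadraticChar_dichotomy h)

theorem primeSign_eq_zero_iff (P : MonicPrime F) : primeSign P = 0 ↔ P.1 = X := by
  classical
  have h : primeSign P = 0 ↔ P.1.eval 0 = 0 := by
    rw [primeSign]; convert quadraticChar_eq_zero_iff
  rw [h]
  constructor
  · intro h0
    have hX : (X : F[X]) ∣ P.1 := by rw [X_dvd_iff, coeff_zero_eq_eval_zero, h0]
    exact (eq_of_monic_of_associated monic_X P.2.1
      (irreducible_X.associated_of_dvd P.2.2 hX)).symm
  · intro h; simp [h]

theorem primeSign_eq_neg_one_iff (P : MonicPrime F) :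
    primeSign P = -1 ↔ ¬ IsSquare (P.1.eval 0) := by
  classical
  rw [primeSign]
  convert quadraticChar_neg_one_iff_not_isSquare

theorem isPlusForm_of_primeSign (hF : Odd (Fintype.card F)) (P : MonicPrime F)
    (h : primeSign P ≠ -1) : IsPlusForm P.1 := by
  by_cases h0 : P.1.eval 0 = 0
  · have : P.1 = X := (primeSign_eq_zero_iff P).1 (by simp [primeSign, h0])
    rw [this]
    exact isPlusForm_X
  · obtain ⟨r, hr⟩ := not_not.1 (mt (primeSign_eq_neg_one_iff P).2 h)
    have hr0 : r ≠ 0 := by rintro rfl; exact h0 (by simpa using hr)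
    exact isPlusForm_of_eval_zero hF P.2.1 P.2.2 hr0 (by rw [hr, sq])

/-- A monic polynomial has the form `A ^ 2 + T * B ^ 2` if and only if every inert prime divides it
to an even power. -/
theorem isPlusForm_ofExp_iff (hF : Odd (Fintype.card F)) (e : MonicPrime F →₀ ℕ) :
    IsPlusForm (ofExp e) ↔ ∀ P, primeSign P = -1 → Even (e P) := by
  constructor
  · rintro ⟨A, B, h⟩ P hP
    exact even_of_sq_add_eq_pow_mul P.2.1 P.2.2 ((primeSign_eq_neg_one_iff P).1 hP) _ A B _
      (h.symm.trans (ofExp_eq_pow_mul e P)) (not_dvd_ofExp_erase e P)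
  · intro h
    refine Finset.prod_induction _ IsPlusForm (fun _ _ => IsPlusForm.mul) isPlusForm_one ?_
    intro P _
    by_cases hP : primeSign P = -1
    · obtain ⟨k, hk⟩ := h P hP
      dsimp only
      rw [hk, ← two_mul, mul_comm, pow_mul]
      exact isPlusForm_sq _
    · exact (isPlusForm_of_primeSign hF P hP).pow _

theorem eval_zero_ofExp_ne_zero_iff (e : MonicPrime F →₀ ℕ) :
    (ofExp e).eval 0 ≠ 0 ↔ ∀ P, primeSign P = 0 → e P = 0 := by
  let T : MonicPrime F := ⟨X, monic_X, irreducible_X⟩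
  have h1 : (ofExp e).eval 0 = 0 ↔ 1 ≤ e T := by
    rw [← coeff_zero_eq_eval_zero, ← X_dvd_iff, ← pow_dvd_ofExp_iff, pow_one]
  rw [Ne, h1]
  constructor
  · intro h P hP
    have : P = T := Subtype.ext ((primeSign_eq_zero_iff P).1 hP)
    rw [this]; omega
  · intro h
    have := h T ((primeSign_eq_zero_iff T).2 rfl)
    omega

/-- The local weight at a prime of sign `t` of the set of polynomials `A ^ 2 + T * B ^ 2`. -/
noncomputable def weightB (t : ℤ) (k : ℕ) : ℝ := open scoped Classical in
  if t = -1 → Even k then 1 else 0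

/-- The local weight at a prime of sign `t` of the set of squarefree polynomials
`A ^ 2 + T * B ^ 2` prime to `T`. -/
noncomputable def weightS (t : ℤ) (k : ℕ) : ℝ := open scoped Classical in
  if k ≤ 1 ∧ (t ≠ 1 → k = 0) then 1 else 0

theorem prod_ite_eq_ite_forall {ι : Type*} (e : ι →₀ ℕ) (p : ι → ℕ → Prop)
    (h0 : ∀ i, p i 0) [∀ i k, Decidable (p i k)] [Decidable (∀ i, p i (e i))] :
    (e.prod fun i k => if p i k then (1 : ℝ) else 0) = if ∀ i, p i (e i) then 1 else 0 := by
  rw [Finsupp.prod, Finset.prod_boole]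
  refine if_congr ⟨fun h i => ?_, fun h i _ => h i⟩ rfl rfl
  by_cases hi : i ∈ e.support
  · exact h i hi
  · rw [Finsupp.notMem_support_iff.1 hi]; exact h0 i

open scoped Classical in
theorem indicator_plusForm_ofExp (hF : Odd (Fintype.card F)) (e : MonicPrime F →₀ ℕ) :
    (if IsPlusForm (ofExp e) then (1 : ℝ) else 0) = e.prod fun P => weightB (primeSign P) := by
  change _ = e.prod fun P k => if primeSign P = -1 → Even k then (1 : ℝ) else 0
  rw [prod_ite_eq_ite_forall e (fun P k => primeSign P = -1 → Even k) (by simp)]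
  exact if_congr (isPlusForm_ofExp_iff hF e) rfl rfl

open scoped Classical in
theorem indicator_squarefree_plusForm_ofExp (hF : Odd (Fintype.card F))
    (e : MonicPrime F →₀ ℕ) :
    (if Squarefree (ofExp e) ∧ (ofExp e).eval 0 ≠ 0 ∧ IsPlusForm (ofExp e) then (1 : ℝ) else 0) =
      e.prod fun P => weightS (primeSign P) := by
  change _ = e.prod fun P k => if k ≤ 1 ∧ (primeSign P ≠ 1 → k = 0) then (1 : ℝ) else 0
  rw [prod_ite_eq_ite_forall e (fun P k => k ≤ 1 ∧ (primeSign P ≠ 1 → k = 0)) (by simp)]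
  refine if_congr ?_ rfl rfl
  rw [squarefree_ofExp_iff, eval_zero_ofExp_ne_zero_iff, isPlusForm_ofExp_iff hF,
    ← forall_and, ← forall_and]
  refine forall_congr' fun P => ?_
  rcases primeSign_cases P with h | h | h
  · simp only [h]; norm_num
  · simp [h]
  · simp only [h]; norm_num
    intro h1
    constructor
    · rintro ⟨j, hj⟩
      omega
    · intro h2
      simp [h2]

open scoped Classical in
theorem quadraticChar_eval_ofExp (e : MonicPrime F →₀ ℕ) :
    ((quadraticChar F ((ofExp e).eval 0) : ℤ) : ℝ) =
      e.prod fun P k => ((primeSign P : ℤ) : ℝ) ^ k := by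
  rw [ofExp, Finsupp.prod, Finsupp.prod, eval_prod, map_prod, Int.cast_prod]
  refine Finset.prod_congr rfl fun P _ => ?_
  rw [eval_pow, map_pow, Int.cast_pow]
  rfl

end Local

/-! ### Generating functions and their functional equations -/

section GenFun
open scoped PowerSeries PowerSeries.WithPiTopology

/-- The series `∑ q ^ n * u ^ n`, which is the zeta function of `F[T]` if `F` has `q` elements. -/
noncomputable def genZeta (q : ℝ) : ℝ⟦X⟧ := PowerSeries.mk fun n => q ^ n

theorem one_sub_mul_genZeta (q : ℝ) :
    (1 - PowerSeries.C q * PowerSeries.X) * genZeta q = 1 := by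
  ext n
  cases n with
  | zero => simp [genZeta]
  | succ n =>
    rw [sub_mul, one_mul, map_sub, mul_assoc, PowerSeries.coeff_C_mul,
      PowerSeries.coeff_succ_X_mul, PowerSeries.coeff_one]
    simp [genZeta, pow_succ']

theorem squarefree_comp_neg_X {F : Type*} [Field F] {f : F[X]} :
    Squarefree (f.comp (-X)) ↔ Squarefree f := by
  have key : ∀ g : F[X], Squarefree g → Squarefree (g.comp (-X)) := by
    rintro g hg x ⟨y, hy⟩
    have h1 : g = x.comp (-X) * x.comp (-X) * y.comp (-X) := by
      rw [← comp_neg_X_comp_neg_X g, hy, mul_comp, mul_comp]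
    have h2 := (hg (x.comp (-X)) ⟨_, h1⟩).map (compRingHom (-X))
    rwa [coe_compRingHom_apply, comp_neg_X_comp_neg_X] at h2
  exact ⟨fun h => by simpa only [comp_neg_X_comp_neg_X] using key _ h, key f⟩

theorem countB_zero (F : Type*) [Field F] : countB F 0 = 1 := by
  have : {f ∈ monicPolys F 0 | IsPlusForm f} = {1} := by
    ext f
    constructor
    · rintro ⟨⟨hm, hd⟩, _⟩
      exact hm.natDegree_eq_zero.1 hd
    · rintro rfl
      exact ⟨⟨monic_one, natDegree_one⟩, isPlusForm_one⟩
  rw [countB, this, Set.ncard_singleton]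

variable (F : Type*) [Field F]

/-- The generating function of the numbers of polynomials `A ^ 2 + T * B ^ 2`. -/
noncomputable def genB : ℝ⟦X⟧ := PowerSeries.mk fun n => (countB F n : ℝ)

/-- The generating function of the numbers `countS`. -/
noncomputable def genS : ℝ⟦X⟧ := PowerSeries.mk fun n => (countS F n : ℝ)


/-- Replacing `f(T)` by `(-1) ^ n * f(-T)` turns the sign twisted form `A ^ 2 - T * B ^ 2` into
the form `A ^ 2 + T * B ^ 2`. -/
theorem countS_eq (n : ℕ) : countS F n =
    {f ∈ monicPolys F n | Squarefree f ∧ f.eval 0 ≠ 0 ∧ IsPlusForm f}.ncard := by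
  let τ : F[X] → F[X] := fun f => (-1) ^ n * f.comp (-X)
  have h1 : ((-1 : F[X]) ^ n) * (-1) ^ n = 1 := by rw [← mul_pow]; simp
  have hcomp : ∀ f, (τ f).comp (-X) = (-1) ^ n * f := by
    intro f
    simp only [τ, mul_comp, pow_comp, neg_comp, one_comp, comp_neg_X_comp_neg_X]
  have hττ : ∀ f, τ (τ f) = f := by
    intro f
    change (-1) ^ n * (τ f).comp (-X) = f
    rw [hcomp, ← mul_assoc, h1, one_mul]
  have hu : IsUnit ((-1 : F[X]) ^ n) := isUnit_one.neg.pow n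
  have hsq : ∀ f, Squarefree (τ f) ↔ Squarefree f := fun f =>
    (associated_unit_mul_left _ _ hu).squarefree_iff.trans squarefree_comp_neg_X
  have hev : ∀ f : F[X], (τ f).eval 0 ≠ 0 ↔ f.eval 0 ≠ 0 := by
    intro f
    simp [τ, eval_comp]
  have hmon : ∀ f, f ∈ monicPolys F n → τ f ∈ monicPolys F n := by
    rintro f ⟨hm, rfl⟩
    refine ⟨hm.neg_one_pow_natDegree_mul_comp_neg_X, ?_⟩
    have h2 : natDegree (-X : F[X]) = 1 := by rw [natDegree_neg, natDegree_X]
    have h3 : ((-1 : F[X]) ^ f.natDegree) = C ((-1) ^ f.natDegree) := by simp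
    simp only [τ]
    rw [h3, natDegree_C_mul (by simp), natDegree_comp, h2, mul_one]
  have hform : ∀ f, IsPlusForm (τ f) ↔ IsMinusForm ((-1) ^ n * f) := by
    intro f
    rw [← isMinusForm_comp_neg_X, hcomp]
  have hinj : Function.Injective τ := Function.LeftInverse.injective hττ
  rw [countS, ← Set.ncard_image_of_injective _ hinj]
  congr 1
  ext f
  constructor
  · rintro ⟨g, ⟨hg, h2, h3, h4⟩, rfl⟩
    exact ⟨hmon g hg, (hsq g).2 h2, (hev g).2 h3, (hform g).2 h4⟩
  · rintro ⟨hf, h2, h3, h4⟩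
    refine ⟨τ f, ⟨hmon f hf, (hsq f).2 h2, (hev f).2 h3, ?_⟩, hττ f⟩
    rwa [← hform, hττ]

variable [Fintype F]

theorem countB_le (n : ℕ) : countB F n ≤ Fintype.card F ^ n := by
  rw [← ncard_monicPolys]
  exact Set.ncard_le_ncard (Set.sep_subset _ _) (finite_monicPolys F n)

open scoped Classical in
/-- The `L`-function of the quadratic character `f ↦ η(f(0))` is `1`: multiplying the constant term
by a non-square changes the sign of the character sum in every positive degree. -/
theorem sum_quadraticChar_eval (hF : Odd (Fintype.card F)) :
    (PowerSeries.mk fun n => ∑ f ∈ (finite_monicPolys F n).toFinset,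
      ((quadraticChar F (f.eval 0) : ℤ) : ℝ)) = 1 := by
  have h2 : ringChar F ≠ 2 := by
    intro h
    have := FiniteField.even_card_iff_char_two.1 h
    have := Nat.odd_iff.1 hF
    omega
  ext n
  rw [PowerSeries.coeff_mk, PowerSeries.coeff_one]
  split_ifs with hn
  · subst hn
    have : (finite_monicPolys F 0).toFinset = {1} := by
      ext f
      rw [Set.Finite.mem_toFinset, Finset.mem_singleton]
      exact ⟨fun h => h.1.natDegree_eq_zero.1 h.2,
        fun h => h ▸ ⟨monic_one, natDegree_one⟩⟩
    rw [this, Finset.sum_singleton, eval_one, map_one, Int.cast_one]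
  · obtain ⟨a, ha⟩ := quadraticChar_exists_neg_one h2
    have ha0 : a ≠ 0 := by rintro rfl; simp at ha
    -- the map multiplying the constant term by `b`
    let σ : F → F[X] → F[X] := fun b f => f + C ((b - 1) * f.eval 0)
    have hσev : ∀ b f, (σ b f).eval 0 = b * f.eval 0 := by
      intro b f; simp only [σ, eval_add, eval_C]; ring
    have hσσ : ∀ b c f, c * b = 1 → σ c (σ b f) = f := by
      intro b c f h
      change σ b f + C ((c - 1) * (σ b f).eval 0) = f
      rw [hσev]
      simp only [σ]
      rw [add_assoc, ← C_add]
      have : (b - 1) * eval 0 f + (c - 1) * (b * eval 0 f) = 0 := by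
        linear_combination (eval 0 f) * h
      rw [this, C_0, add_zero]
    have hσm : ∀ b, ∀ f ∈ (finite_monicPolys F n).toFinset,
        σ b f ∈ (finite_monicPolys F n).toFinset := by
      intro b f hf
      rw [Set.Finite.mem_toFinset] at hf ⊢
      obtain ⟨hm, hd⟩ := hf
      refine ⟨hm.add_of_left ?_, ?_⟩
      · refine degree_C_le.trans_lt ?_
        rw [degree_eq_natDegree hm.ne_zero, hd]
        exact_mod_cast Nat.pos_of_ne_zero hn
      · simp only [σ]
        rw [natDegree_add_C, hd]
    have key : ∑ f ∈ (finite_monicPolys F n).toFinset, ((quadraticChar F (f.eval 0) : ℤ) : ℝ) =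
        ∑ f ∈ (finite_monicPolys F n).toFinset, -((quadraticChar F (f.eval 0) : ℤ) : ℝ) := by
      refine Finset.sum_nbij' (σ a) (σ a⁻¹) (hσm a) (hσm a⁻¹)
        (fun f _ => hσσ _ _ _ (inv_mul_cancel₀ ha0)) (fun f _ => hσσ _ _ _ (mul_inv_cancel₀ ha0))
        fun f _ => ?_
      rw [hσev, map_mul, ha]
      simp
    rw [Finset.sum_neg_distrib] at key
    linarith

section Products
variable {F}

/-- The local factor at a prime `P` of an Euler product, built from a power series depending on the
sign of `P`. -/
noncomputable def eulerFactor (a : ℤ → ℝ⟦X⟧) (P : MonicPrime F) : ℝ⟦X⟧ :=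
  PowerSeries.expand (primeDeg P) (primeDeg_ne_zero P) (a (primeSign P))

theorem eulerFactor_mul (a b : ℤ → ℝ⟦X⟧) (P : MonicPrime F) :
    eulerFactor (a * b) P = eulerFactor a P * eulerFactor b P := map_mul _ _ _

theorem hasProd_eulerFactor_mul {a b : ℤ → ℝ⟦X⟧} {f g : ℝ⟦X⟧}
    (hf : HasProd (eulerFactor (F := F) a) f) (hg : HasProd (eulerFactor (F := F) b) g) :
    HasProd (eulerFactor (F := F) (a * b)) (f * g) := by
  have := hf.mul hg
  simpa only [← eulerFactor_mul] using this

theorem hasProd_eulerFactor_expand {a : ℤ → ℝ⟦X⟧} {f : ℝ⟦X⟧}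
    (hf : HasProd (eulerFactor (F := F) a) f) :
    HasProd (eulerFactor (F := F) fun t => PowerSeries.expand 2 two_ne_zero (a t))
      (PowerSeries.expand 2 two_ne_zero f) := by
  have := hf.map (PowerSeries.expand 2 two_ne_zero) (continuous_expand 2 two_ne_zero)
  convert this using 1
  ext1 P
  simp only [eulerFactor, Function.comp_apply]
  rw [← PowerSeries.expand_mul, ← PowerSeries.expand_mul]
  simp only [mul_comm]

/-- Two Euler products are equal if their local factors agree at the three possible signs. -/
theorem hasProd_eulerFactor_unique {a b : ℤ → ℝ⟦X⟧} {f g : ℝ⟦X⟧}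
    (hf : HasProd (eulerFactor (F := F) a) f) (hg : HasProd (eulerFactor (F := F) b) g)
    (h : ∀ t, t = 0 ∨ t = 1 ∨ t = -1 → a t = b t) : f = g := by
  refine hf.unique ?_
  convert hg using 1
  ext1 P
  rw [eulerFactor, eulerFactor, h _ (primeSign_cases P)]

/-- The factor `1 - u` at the ramified prime `T`. -/
noncomputable def ramifiedFactor (t : ℤ) : ℝ⟦X⟧ := if t = 0 then 1 - PowerSeries.X else 1

theorem hasProd_ramifiedFactor :
    HasProd (eulerFactor (F := F) ramifiedFactor) (1 - PowerSeries.X) := by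
  classical
  let T : MonicPrime F := ⟨X, monic_X, irreducible_X⟩
  convert hasProd_ite_eq T (1 - PowerSeries.X : ℝ⟦X⟧) using 1
  ext1 P
  have hPT : primeSign P = 0 ↔ P = T := by rw [primeSign_eq_zero_iff, Subtype.ext_iff]
  by_cases h : P = T
  · have hd : primeDeg P = 1 := by rw [h, primeDeg, natDegree_X]
    simp only [eulerFactor, ramifiedFactor, if_pos (hPT.2 h), if_pos h, hd]
    simp
  · simp only [eulerFactor, ramifiedFactor, if_neg (mt hPT.1 h), if_neg h, map_one]

theorem hasProd_genZeta :
    HasProd (eulerFactor (F := F) fun _ => PowerSeries.mk fun _ => 1)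
      (genZeta (Fintype.card F)) := by
  have := hasProd_genFun (F := F) (c := fun _ _ => 1) (fun _ => rfl) (g := fun _ => 1)
    (fun e => by simp [Finsupp.prod])
  suffices h : genZeta (Fintype.card F) = PowerSeries.mk _ by
    rw [h]; exact this
  ext n
  rw [genZeta, PowerSeries.coeff_mk, PowerSeries.coeff_mk, Finset.sum_const, nsmul_one,
    ← Set.ncard_eq_toFinset_card _ (finite_monicPolys F n), ncard_monicPolys]
  push_cast
  rfl

theorem hasProd_genB (hF : Odd (Fintype.card F)) :
    HasProd (eulerFactor (F := F) fun t => PowerSeries.mk (weightB t)) (genB F) := by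
  classical
  have := hasProd_genFun (F := F) (c := fun P => weightB (primeSign P))
    (fun P => by simp [weightB]) (g := fun f => if IsPlusForm f then 1 else 0)
    (indicator_plusForm_ofExp hF)
  suffices h : genB F = PowerSeries.mk _ by
    rw [h]; exact this
  ext n
  rw [genB, PowerSeries.coeff_mk, PowerSeries.coeff_mk, countB, ncard_eq_sum]

theorem hasProd_genS (hF : Odd (Fintype.card F)) :
    HasProd (eulerFactor (F := F) fun t => PowerSeries.mk (weightS t)) (genS F) := by
  classical
  have := hasProd_genFun (F := F) (c := fun P => weightS (primeSign P))
    (fun P => by simp [weightS]) 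
    (g := fun f => if Squarefree f ∧ f.eval 0 ≠ 0 ∧ IsPlusForm f then 1 else 0)
    (indicator_squarefree_plusForm_ofExp hF)
  suffices h : genS F = PowerSeries.mk _ by
    rw [h]; exact this
  ext n
  rw [genS, PowerSeries.coeff_mk, PowerSeries.coeff_mk, countS_eq, ncard_eq_sum]

theorem hasProd_quadraticChar (hF : Odd (Fintype.card F)) :
    HasProd (eulerFactor (F := F) fun t => PowerSeries.mk fun k => (t : ℝ) ^ k) 1 := by
  classical
  have := hasProd_genFun (F := F) (c := fun P k => ((primeSign P : ℤ) : ℝ) ^ k)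
    (fun P => pow_zero _)
    (g := fun f => ((quadraticChar F (f.eval 0) : ℤ) : ℝ)) quadraticChar_eval_ofExp
  rwa [sum_quadraticChar_eval F hF] at this

/-- The inverse of `1 - u`. -/
theorem one_sub_X_mul_mk : (1 - PowerSeries.X) * (PowerSeries.mk fun _ => 1 : ℝ⟦X⟧) = 1 := by
  exact (mul_comm _ _).trans (PowerSeries.mk_one_mul_one_sub_eq_one ℝ)

theorem one_sub_X_sq_mul_expand_mk :
    (1 - PowerSeries.X ^ 2) *
      PowerSeries.expand 2 two_ne_zero (PowerSeries.mk fun _ => 1 : ℝ⟦X⟧) = 1 := by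
  have := congrArg (PowerSeries.expand 2 two_ne_zero) one_sub_X_mul_mk
  simpa using this

theorem mk_weightB_of_ne {t : ℤ} (h : t ≠ -1) :
    PowerSeries.mk (weightB t) = PowerSeries.mk fun _ => 1 := by
  ext n; simp [weightB, h]

theorem mk_weightB_neg_one : PowerSeries.mk (weightB (-1)) =
    PowerSeries.expand 2 two_ne_zero (PowerSeries.mk fun _ => 1 : ℝ⟦X⟧) := by
  ext n; simp [weightB, PowerSeries.coeff_expand, even_iff_two_dvd]

theorem mk_weightS_of_ne {t : ℤ} (h : t ≠ 1) : PowerSeries.mk (weightS t) = 1 := by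
  ext n
  rw [PowerSeries.coeff_mk, weightS, PowerSeries.coeff_one]
  refine if_congr ?_ rfl rfl
  constructor
  · exact fun h1 => h1.2 h
  · rintro rfl; simp

theorem mk_weightS_one : PowerSeries.mk (weightS 1) = 1 + PowerSeries.X := by
  ext n
  rw [PowerSeries.coeff_mk, weightS, map_add, PowerSeries.coeff_one, PowerSeries.coeff_X]
  rcases n with _ | _ | n <;> simp

theorem mk_zero_pow : (PowerSeries.mk fun k => ((0 : ℤ) : ℝ) ^ k) = 1 := by
  ext n
  rw [PowerSeries.coeff_mk, PowerSeries.coeff_one]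
  rcases n with _ | n <;> simp

theorem one_add_X_mul_mk :
    (1 + PowerSeries.X) * (PowerSeries.mk fun k => ((-1 : ℤ) : ℝ) ^ k) = 1 := by
  have := one_sub_mul_genZeta (-1)
  simpa [genZeta] using this

/-- The functional equation of the generating function `D` of the forms `A ^ 2 + T * B ^ 2`:
`D(u) ^ 2 = (1 + u) / (1 - q * u) * D(u ^ 2)`. The Euler factors satisfy
`(1 - u) D(u) ^ 2 L(u ^ 2) = (1 - u ^ 2) Z(u) D(u ^ 2) L(u)`, where `Z` is the zeta function,
`L = 1` is the `L`-function of the quadratic character and `1 - u` is the factor at `T`. -/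
theorem genB_functional (hF : Odd (Fintype.card F)) :
    (1 - PowerSeries.C (Fintype.card F : ℝ) * PowerSeries.X) * genB F ^ 2 =
      (1 + PowerSeries.X) * PowerSeries.expand 2 two_ne_zero (genB F) := by
  have hB := hasProd_genB hF
  have hL := hasProd_quadraticChar (F := F) hF
  have hU := hasProd_ramifiedFactor (F := F)
  have hZ := hasProd_genZeta (F := F)
  have h1 := hasProd_eulerFactor_mul (hasProd_eulerFactor_mul hU
    (hasProd_eulerFactor_mul hB hB)) (hasProd_eulerFactor_expand hL)
  have h2 := hasProd_eulerFactor_mul (hasProd_eulerFactor_mul (hasProd_eulerFactor_mul hZ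
    (hasProd_eulerFactor_expand hU)) (hasProd_eulerFactor_expand hB)) hL
  have key := hasProd_eulerFactor_unique h1 h2 ?_
  · have hne : (1 - PowerSeries.X : ℝ⟦X⟧) ≠ 0 := left_ne_zero_of_mul_eq_one one_sub_X_mul_mk
    refine mul_left_cancel₀ hne ?_
    simp only [map_one, mul_one, map_sub, PowerSeries.expand_X] at key
    linear_combination (1 - PowerSeries.C (Fintype.card F : ℝ) * PowerSeries.X) * key +
      (1 - PowerSeries.X ^ 2) * PowerSeries.expand 2 two_ne_zero (genB F) *
        one_sub_mul_genZeta (Fintype.card F : ℝ)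
  · have ha := one_sub_X_mul_mk
    have hb := one_sub_X_sq_mul_expand_mk
    have hg := one_add_X_mul_mk
    have hg' := congrArg (PowerSeries.expand 2 two_ne_zero) hg
    have hc := congrArg (PowerSeries.expand 2 two_ne_zero) hb
    simp only [map_mul, map_sub, map_add, map_one, map_pow, PowerSeries.expand_X] at hg' hc
    intro t ht
    simp only [Pi.mul_apply]
    rcases ht with rfl | rfl | rfl
    · rw [mk_weightB_of_ne (by decide), mk_zero_pow]
      simp only [ramifiedFactor, if_true, map_one, map_sub, PowerSeries.expand_X]
      linear_combination (PowerSeries.mk fun _ => 1) * ha - (PowerSeries.mk fun _ => 1) * hb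
    · rw [mk_weightB_of_ne (by decide)]
      simp [ramifiedFactor]
      ring
    -- at an inert prime: `1 / ((1 - u²)² (1 + u²)) = 1 / ((1 - u) (1 - u⁴) (1 + u))`
    · rw [mk_weightB_neg_one]
      simp only [ramifiedFactor, if_neg (show (-1 : ℤ) ≠ 0 by decide), map_one]
      generalize (PowerSeries.mk fun k => ((-1 : ℤ) : ℝ) ^ k) = g at *
      generalize (PowerSeries.mk fun _ => 1 : ℝ⟦X⟧) = a at *
      generalize PowerSeries.expand 2 two_ne_zero a = b at *
      generalize PowerSeries.expand 2 two_ne_zero b = c at *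
      generalize PowerSeries.expand 2 two_ne_zero g = g' at *
      have e1 : b = a * g := by
        linear_combination (-b) * (1 + PowerSeries.X) * g * ha - b * hg + a * g * hb
      have e2 : c = b * g' := by
        linear_combination (-c) * (1 + PowerSeries.X ^ 2) * g' * hb - c * hg' + b * g' * hc
      rw [e2]
      linear_combination b * g' * e1

/-- The relation between the two generating functions, coming from the unique decomposition of a
form `A ^ 2 + T * B ^ 2` as a power of `T` times a squarefree one times a square. -/
theorem genS_functional (hF : Odd (Fintype.card F)) :
    (1 - PowerSeries.C (Fintype.card F : ℝ) * PowerSeries.X ^ 2) * genB F =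
      (1 + PowerSeries.X) * genS F := by
  have hU := hasProd_ramifiedFactor (F := F)
  have h1 := hasProd_eulerFactor_mul hU (hasProd_genB hF)
  have h2 := hasProd_eulerFactor_mul (hasProd_eulerFactor_mul (hasProd_eulerFactor_expand hU)
    (hasProd_genS hF)) (hasProd_eulerFactor_expand (hasProd_genZeta (F := F)))
  have key := hasProd_eulerFactor_unique h1 h2 ?_
  · have hz := congrArg (PowerSeries.expand 2 two_ne_zero)
      (one_sub_mul_genZeta (Fintype.card F : ℝ))
    simp only [map_mul, map_sub, map_one, PowerSeries.expand_X, PowerSeries.expand_C] at hz key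
    have hne : (1 - PowerSeries.X : ℝ⟦X⟧) ≠ 0 := left_ne_zero_of_mul_eq_one one_sub_X_mul_mk
    refine mul_left_cancel₀ hne ?_
    linear_combination (1 - PowerSeries.C (Fintype.card F : ℝ) * PowerSeries.X ^ 2) * key +
      (1 - PowerSeries.X ^ 2) * genS F * hz
  · have ha := one_sub_X_mul_mk
    have hb := one_sub_X_sq_mul_expand_mk
    intro t ht
    simp only [Pi.mul_apply]
    rcases ht with rfl | rfl | rfl
    · rw [mk_weightB_of_ne (by decide), mk_weightS_of_ne (by decide)]
      simp only [ramifiedFactor, if_true, map_one, map_sub, PowerSeries.expand_X]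
      linear_combination ha - hb
    · rw [mk_weightB_of_ne (by decide), mk_weightS_one]
      simp only [ramifiedFactor, if_neg (show (1 : ℤ) ≠ 0 by decide), map_one, one_mul]
      generalize (PowerSeries.mk fun _ => 1 : ℝ⟦X⟧) = a at *
      generalize PowerSeries.expand 2 two_ne_zero a = b at *
      linear_combination (1 + PowerSeries.X) * b * ha - a * hb
    · rw [mk_weightB_neg_one, mk_weightS_of_ne (by decide)]
      simp [ramifiedFactor]

end Products
end GenFun

/-! ### Sums of absolute values of coefficients -/

section CoeffNorm
open Finset
open scoped PowerSeries
open PowerSeries (coeff mk expand)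

/-- The sum of the absolute values of the coefficients of `u ^ 0, …, u ^ N`. -/
noncomputable def coeffNorm (N : ℕ) (f : ℝ⟦X⟧) : ℝ := ∑ i ∈ range (N + 1), |coeff i f|

theorem coeffNorm_nonneg (N : ℕ) (f : ℝ⟦X⟧) : 0 ≤ coeffNorm N f :=
  sum_nonneg fun _ _ => abs_nonneg _

theorem coeffNorm_add_le (N : ℕ) (f g : ℝ⟦X⟧) :
    coeffNorm N (f + g) ≤ coeffNorm N f + coeffNorm N g := by
  rw [coeffNorm, coeffNorm, coeffNorm, ← sum_add_distrib]
  exact sum_le_sum fun i _ => by rw [map_add]; exact abs_add_le _ _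

theorem coeffNorm_neg (N : ℕ) (f : ℝ⟦X⟧) : coeffNorm N (-f) = coeffNorm N f := by
  simp [coeffNorm]

theorem coeffNorm_sub_le (N : ℕ) (f g : ℝ⟦X⟧) :
    coeffNorm N (f - g) ≤ coeffNorm N f + coeffNorm N g := by
  rw [sub_eq_add_neg, ← coeffNorm_neg N g]
  exact coeffNorm_add_le _ _ _

theorem coeffNorm_smul (N : ℕ) (a : ℝ) (f : ℝ⟦X⟧) :
    coeffNorm N (a • f) = |a| * coeffNorm N f := by
  simp [coeffNorm, mul_sum, abs_mul]

theorem coeffNorm_mul_le (N : ℕ) (f g : ℝ⟦X⟧) :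
    coeffNorm N (f * g) ≤ coeffNorm N f * coeffNorm N g := by
  have h1 : coeffNorm N (f * g) ≤
      ∑ n ∈ range (N + 1), ∑ p ∈ antidiagonal n, |coeff p.1 f| * |coeff p.2 g| := by
    refine sum_le_sum fun n _ => ?_
    rw [PowerSeries.coeff_mul]
    refine (abs_sum_le_sum_abs _ _).trans_eq ?_
    exact sum_congr rfl fun p _ => abs_mul _ _
  refine h1.trans ?_
  rw [coeffNorm, coeffNorm, sum_mul_sum, ← sum_product', ← sum_biUnion]
  · refine sum_le_sum_of_subset_of_nonneg ?_ fun p _ _ => by positivity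
    intro p hp
    simp only [mem_biUnion, mem_range, HasAntidiagonal.mem_antidiagonal, mem_product] at hp ⊢
    omega
  · intro m _ n _ hmn
    rw [Function.onFun, disjoint_left]
    intro p hp hp'
    exact hmn ((HasAntidiagonal.mem_antidiagonal.1 hp).symm.trans
      (HasAntidiagonal.mem_antidiagonal.1 hp'))

theorem coeffNorm_mono (f : ℝ⟦X⟧) {M N : ℕ} (h : M ≤ N) : coeffNorm M f ≤ coeffNorm N f :=
  sum_le_sum_of_subset_of_nonneg (range_subset_range.2 (by omega)) fun _ _ _ => abs_nonneg _

theorem coeffNorm_succ_X_mul (N : ℕ) (f : ℝ⟦X⟧) :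
    coeffNorm (N + 1) (PowerSeries.X * f) = coeffNorm N f := by
  rw [coeffNorm, sum_range_succ']
  simp [coeffNorm, PowerSeries.coeff_succ_X_mul]

theorem coeffNorm_X_mul_le (N : ℕ) (f : ℝ⟦X⟧) : coeffNorm N (PowerSeries.X * f) ≤ coeffNorm N f :=
  (coeffNorm_mono _ N.le_succ).trans (coeffNorm_succ_X_mul N f).le

theorem coeffNorm_X_pow_mul_le (N k : ℕ) (f : ℝ⟦X⟧) :
    coeffNorm N (PowerSeries.X ^ k * f) ≤ coeffNorm N f := by
  induction k with
  | zero => simp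
  | succ k ih => rw [pow_succ', mul_assoc]; exact (coeffNorm_X_mul_le _ _).trans ih

theorem coeffNorm_one (N : ℕ) : coeffNorm N 1 = 1 := by
  rw [coeffNorm, sum_range_succ']
  simp [PowerSeries.coeff_one]

theorem coeffNorm_smul_X_pow_le (N : ℕ) (a : ℝ) (k : ℕ) :
    coeffNorm N (a • (PowerSeries.X ^ k : ℝ⟦X⟧)) ≤ |a| := by
  have h := coeffNorm_X_pow_mul_le N k 1
  rw [mul_one, coeffNorm_one] at h
  rw [coeffNorm_smul]
  exact mul_le_of_le_one_right (abs_nonneg _) h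

theorem coeffNorm_one_add_smul_X_mul_le (N : ℕ) (a : ℝ) (f : ℝ⟦X⟧) :
    coeffNorm N ((1 + a • PowerSeries.X) * f) ≤ (1 + |a|) * coeffNorm N f := by
  rw [add_mul, one_mul, smul_mul_assoc, one_add_mul]
  refine (coeffNorm_add_le _ _ _).trans (add_le_add_right ?_ _)
  rw [coeffNorm_smul]
  exact mul_le_mul_of_nonneg_left (coeffNorm_X_mul_le _ _) (abs_nonneg _)

theorem coeffNorm_expand_le (N : ℕ) (f : ℝ⟦X⟧) :
    coeffNorm N (expand 2 two_ne_zero f) ≤ coeffNorm N f := by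
  have h : coeffNorm N (expand 2 two_ne_zero f) =
      ∑ i ∈ (range (N + 1)).filter (2 ∣ ·), |coeff (i / 2) f| := by
    rw [coeffNorm, sum_filter]
    refine sum_congr rfl fun i _ => ?_
    rw [PowerSeries.coeff_expand]
    split_ifs <;> simp
  rw [h, ← sum_image (g := fun i => i / 2) (f := fun i => |coeff i f|)]
  · refine sum_le_sum_of_subset_of_nonneg ?_ fun _ _ _ => abs_nonneg _
    intro i hi
    simp only [mem_image, mem_filter, mem_range] at hi ⊢
    omega
  · intro i hi j hj hij
    simp only [coe_filter, Set.mem_ofPred_eq] at hi hj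
    dsimp only at hij
    omega

theorem coeffNorm_mk_le {x : ℝ} (hx : 0 ≤ x) (hx3 : x ≤ 1 / 3) {a : ℕ → ℝ}
    (ha : ∀ n, |a n| ≤ 1) (N : ℕ) : coeffNorm N (mk fun n => x ^ n * a n) ≤ 3 / 2 := by
  have h1 : coeffNorm N (mk fun n => x ^ n * a n) ≤ ∑ i ∈ range (N + 1), x ^ i := by
    refine sum_le_sum fun i _ => ?_
    rw [PowerSeries.coeff_mk, abs_mul, abs_of_nonneg (pow_nonneg hx i)]
    exact mul_le_of_le_one_right (pow_nonneg hx i) (ha i)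
  have h2 := geom_sum_mul_neg x (N + 1)
  have h3 : 0 ≤ x ^ (N + 1) := by positivity
  have h4 : 0 ≤ ∑ i ∈ range (N + 1), x ^ i := sum_nonneg fun _ _ => pow_nonneg hx _
  nlinarith

theorem abs_coeff_mul_le (n : ℕ) (f : ℝ⟦X⟧) {g : ℝ⟦X⟧} (hg : ∀ k, |coeff k g| ≤ 1) :
    |coeff n (f * g)| ≤ coeffNorm n f := by
  rw [PowerSeries.coeff_mul]
  refine (abs_sum_le_sum_abs _ _).trans ?_
  rw [coeffNorm, Finset.Nat.sum_antidiagonal_eq_sum_range_succ_mk]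
  refine sum_le_sum fun i _ => ?_
  rw [abs_mul]
  exact mul_le_of_le_one_right (abs_nonneg _) (hg _)

/-- If `(1 + Z) ^ 2 = 1 + Y` and `Y` has norm at most `1`, then so has `Z`. As `Z` has no constant
term, the coefficients of `Z ^ 2` up to a degree involve only those of `Z` of lower degree, so that
the bound follows by induction on the degree. -/
theorem coeffNorm_le_one_of_sq {Y Z : ℝ⟦X⟧} (h0 : PowerSeries.constantCoeff Z = 0)
    (h : 2 * Z + Z ^ 2 = Y) (hY : ∀ N, coeffNorm N Y ≤ 1) (N : ℕ) : coeffNorm N Z ≤ 1 := by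
  obtain ⟨W, rfl⟩ := PowerSeries.X_dvd_iff.2 h0
  induction N with
  | zero => simp [coeffNorm]
  | succ N ih =>
    have h1 : (2 : ℝ) • (PowerSeries.X * W) = Y - PowerSeries.X * (PowerSeries.X * W * W) := by
      rw [← h]; algebra
    have h2 := coeffNorm_sub_le (N + 1) Y (PowerSeries.X * (PowerSeries.X * W * W))
    rw [← h1, coeffNorm_smul, coeffNorm_succ_X_mul N (PowerSeries.X * W * W)] at h2
    have h3 := coeffNorm_mul_le N (PowerSeries.X * W) W
    have h4 : coeffNorm N (PowerSeries.X * W) * coeffNorm N W ≤ 1 * coeffNorm N W :=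
      mul_le_mul_of_nonneg_right ih (coeffNorm_nonneg _ _)
    have h5 := coeffNorm_succ_X_mul N W
    have h6 := hY (N + 1)
    rw [abs_of_pos two_pos] at h2
    linarith

/-- A family of power series whose norms are bounded uniformly for parameters in `[0, 1]`. -/
def UniformlyBounded (f : ℝ → ℝ⟦X⟧) : Prop :=
  ∃ c : ℝ, ∀ x ∈ Set.Icc (0 : ℝ) 1, ∀ N, coeffNorm N (f x) ≤ c

theorem UniformlyBounded.add {f g : ℝ → ℝ⟦X⟧} (hf : UniformlyBounded f)
    (hg : UniformlyBounded g) : UniformlyBounded fun x => f x + g x := by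
  obtain ⟨c, hc⟩ := hf
  obtain ⟨d, hd⟩ := hg
  exact ⟨c + d, fun x hx N => (coeffNorm_add_le _ _ _).trans (add_le_add (hc x hx N) (hd x hx N))⟩

theorem uniformlyBounded_smul_X_pow {a : ℝ → ℝ} (ha : Continuous a) (k : ℕ) :
    UniformlyBounded fun x => a x • PowerSeries.X ^ k := by
  obtain ⟨c, hc⟩ := isCompact_Icc.exists_bound_of_continuousOn ha.continuousOn
  exact ⟨c, fun x hx N => (coeffNorm_smul_X_pow_le _ _ _).trans (hc x hx)⟩

end CoeffNorm

/-! ### The binomial series -/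

section CentralBinomial
open scoped PowerSeries
open PowerSeries (coeff mk)

/-- The generating function of the normalized central binomial coefficients, the binomial series
`(1 - u) ^ (-1 / 2)`. -/
noncomputable def hSeries : ℝ⟦X⟧ := mk fun k => h k

theorem h_natCast (k : ℕ) : h (k : ℤ) = (k.centralBinom : ℝ) / 4 ^ k := by
  simp [h, Nat.centralBinom]

theorem abs_coeff_hSeries_le (k : ℕ) : |coeff k hSeries| ≤ 1 := by
  rw [hSeries, PowerSeries.coeff_mk, h_natCast, abs_of_nonneg (by positivity),
    div_le_one (by positivity)]
  exact_mod_cast Nat.centralBinom_le_four_pow k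

theorem h_succ (k : ℕ) : 2 * ((k : ℝ) + 1) * h ((k + 1 : ℕ) : ℤ) = (2 * k + 1) * h (k : ℤ) := by
  rw [h_natCast, h_natCast, pow_succ]
  have := Nat.succ_mul_centralBinom_succ k
  have h2 : ((k : ℝ) + 1) * ((k + 1).centralBinom : ℝ) = 2 * (2 * k + 1) * k.centralBinom := by
    exact_mod_cast this
  field_simp
  linear_combination 2 * h2

/-- The series `hSeries` satisfies the differential equation of `(1 - u) ^ (-1 / 2)`. -/
theorem one_sub_X_mul_hSeries_sq : (1 - PowerSeries.X) * hSeries ^ 2 = 1 := by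
  have hode : 2 * (1 - PowerSeries.X) * PowerSeries.derivative ℝ hSeries = hSeries := by
    have : (2 : ℝ) • ((1 - PowerSeries.X) * PowerSeries.derivative ℝ hSeries) = hSeries := by
      ext n
      rw [PowerSeries.coeff_smul, sub_mul, one_mul, map_sub, PowerSeries.coeff_derivative]
      cases n with
      | zero =>
        have := h_succ 0
        simp [hSeries] at this ⊢
        linarith
      | succ n =>
        have := h_succ (n + 1)
        rw [PowerSeries.coeff_succ_X_mul, PowerSeries.coeff_derivative]
        simp only [hSeries, PowerSeries.coeff_mk, smul_eq_mul]
        push_cast at this ⊢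
        linear_combination this
    refine Eq.trans ?_ this
    algebra
  apply PowerSeries.derivative.ext
  · rw [Derivation.leibniz, Derivation.leibniz_pow, map_sub, Derivation.map_one_eq_zero,
      PowerSeries.derivative_X]
    simp only [smul_eq_mul, nsmul_eq_mul, Nat.cast_ofNat, Nat.add_one_sub_one, pow_one]
    linear_combination hSeries * hode
  · simp [hSeries, h]

end CentralBinomial

/-! ### Expansion in powers of `1 / q` -/

section Expansion
open scoped PowerSeries
open PowerSeries (coeff mk expand)

/-- The polynomial in `x = 1 / q` and `u` giving the main terms of the full count. -/
noncomputable def mainPolyB (x : ℝ) : ℝ⟦X⟧ :=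
  1 + (x / 2) • PowerSeries.X + (x / 4 + x ^ 2 / 8) • PowerSeries.X ^ 2 +
    (x ^ 2 / 8 + 3 / 16 * x ^ 3) • PowerSeries.X ^ 3 +
    (5 / 32 * x ^ 2 + 5 / 32 * x ^ 3) • PowerSeries.X ^ 4 + (5 / 64 * x ^ 3) • PowerSeries.X ^ 5 +
    (15 / 128 * x ^ 3) • PowerSeries.X ^ 6

/-- The polynomial in `x = 1 / q` and `u` giving the main terms of the squarefree count. -/
noncomputable def mainPolyS (x : ℝ) : ℝ⟦X⟧ :=
  1 + (-x / 2) • PowerSeries.X + (-3 / 4 * x + 5 / 8 * x ^ 2) • PowerSeries.X ^ 2 +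
    (3 / 8 * x ^ 2 - 7 / 16 * x ^ 3) • PowerSeries.X ^ 3 +
    (-3 / 32 * x ^ 2 - 11 / 32 * x ^ 3) • PowerSeries.X ^ 4 + (3 / 64 * x ^ 3) • PowerSeries.X ^ 5 +
    (-5 / 128 * x ^ 3) • PowerSeries.X ^ 6

/-- The error divided by `x ^ 4` in the square root `mainPolyB x` (see `mainPolyB_sq`). -/
noncomputable def remainderB (x : ℝ) : ℝ⟦X⟧ :=
  ((-5/64) * x ^ 0) • PowerSeries.X ^ 4 +
    ((7/32) * x ^ 0 + (5/64) * x ^ 1) • PowerSeries.X ^ 5 +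
    ((13/128) * x ^ 0 + (13/128) * x ^ 1 + (39/256) * x ^ 2) • PowerSeries.X ^ 6 +
    ((15/128) * x ^ 0 + (25/128) * x ^ 1 + (33/256) * x ^ 2 + (3/16) * x ^ 3) • PowerSeries.X ^ 7 +
    ((-85/1024) * x ^ 0 + (-25/256) * x ^ 1 + (-55/1024) * x ^ 2) • PowerSeries.X ^ 8 +
    ((-55/1024) * x ^ 1 + (-35/512) * x ^ 2) • PowerSeries.X ^ 9 +
    ((-75/2048) * x ^ 1 + (-175/4096) * x ^ 2) • PowerSeries.X ^ 10 +
    ((-75/4096) * x ^ 2) • PowerSeries.X ^ 11 +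
    ((-225/16384) * x ^ 2) • PowerSeries.X ^ 12

/-- The error divided by `x ^ 4` in the relation between `mainPolyS x` and `mainPolyB x` (see
`mainPolyS_eq`). -/
noncomputable def remainderS : ℝ⟦X⟧ :=
  (7 / 16 : ℝ) • PowerSeries.X ^ 4 + (5 / 32 : ℝ) • PowerSeries.X ^ 5 +
    (-13 / 64 : ℝ) • PowerSeries.X ^ 6 + (-5 / 128 : ℝ) • PowerSeries.X ^ 7 +
    (-15 / 128 : ℝ) • PowerSeries.X ^ 8

theorem uniformlyBounded_remainderB : UniformlyBounded remainderB := by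
  refine ((((((((uniformlyBounded_smul_X_pow ?_ 4).add (uniformlyBounded_smul_X_pow ?_ 5)).add
    (uniformlyBounded_smul_X_pow ?_ 6)).add (uniformlyBounded_smul_X_pow ?_ 7)).add
    (uniformlyBounded_smul_X_pow ?_ 8)).add (uniformlyBounded_smul_X_pow ?_ 9)).add
    (uniformlyBounded_smul_X_pow ?_ 10)).add (uniformlyBounded_smul_X_pow ?_ 11)).add
    (uniformlyBounded_smul_X_pow ?_ 12) <;> fun_prop

theorem uniformlyBounded_remainderS : UniformlyBounded fun _ => remainderS := by
  refine ((((uniformlyBounded_smul_X_pow ?_ 4).add (uniformlyBounded_smul_X_pow ?_ 5)).add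
    (uniformlyBounded_smul_X_pow ?_ 6)).add (uniformlyBounded_smul_X_pow ?_ 7)).add
    (uniformlyBounded_smul_X_pow ?_ 8) <;> fun_prop

/-- `mainPolyB` is, up to `O(x ^ 4)`, the square root of `(1 + x * u) * M(u ^ 2)`, where `M` is cut
off after degree 3 and its coefficients `x ^ n * b n` are those found in `initial_coeffs`. -/
theorem mainPolyB_sq (x : ℝ) :
    (1 + x • PowerSeries.X) * (1 + (x * ((1 + x) / 2)) • PowerSeries.X ^ 2 +
      (x ^ 2 * ((3 + 4 * x + x ^ 2) / 8)) • PowerSeries.X ^ 4 +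
      (x ^ 3 * ((5 + 5 * x + 3 * x ^ 2 + 3 * x ^ 3) / 16)) • PowerSeries.X ^ 6) =
    mainPolyB x ^ 2 + x ^ 4 • remainderB x := by
  rw [mainPolyB, remainderB]
  algebra

theorem mainPolyS_eq (x : ℝ) :
    (1 - x • PowerSeries.X ^ 2) * mainPolyB x =
      (1 + x • PowerSeries.X) * mainPolyS x + x ^ 4 • remainderS := by
  rw [mainPolyB, mainPolyS, remainderS]
  algebra

theorem coeffNorm_mainPolyB_sub_one_le {x : ℝ} (hx : 0 ≤ x) (hx3 : x ≤ 1 / 3) (N : ℕ) :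
    coeffNorm N (mainPolyB x - 1) ≤ 2 / 5 := by
  have e : mainPolyB x - 1 = (x / 2) • PowerSeries.X ^ 1 + (x / 4 + x ^ 2 / 8) • PowerSeries.X ^ 2 +
      (x ^ 2 / 8 + 3 / 16 * x ^ 3) • PowerSeries.X ^ 3 +
      (5 / 32 * x ^ 2 + 5 / 32 * x ^ 3) • PowerSeries.X ^ 4 +
      (5 / 64 * x ^ 3) • PowerSeries.X ^ 5 + (15 / 128 * x ^ 3) • PowerSeries.X ^ 6 := by
    rw [mainPolyB]; algebra
  have key : ∀ (f : ℝ⟦X⟧) (c a : ℝ) (k : ℕ), coeffNorm N f ≤ c → 0 ≤ a →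
      coeffNorm N (f + a • PowerSeries.X ^ k) ≤ c + a := fun f c a k hf ha =>
    (coeffNorm_add_le _ _ _).trans
      (add_le_add hf ((coeffNorm_smul_X_pow_le _ _ _).trans (abs_of_nonneg ha).le))
  rw [e]
  refine (key _ _ _ _ (key _ _ _ _ (key _ _ _ _ (key _ _ _ _ (key _ _ _ _
    ((coeffNorm_smul_X_pow_le _ _ _).trans (abs_of_nonneg ?_).le)
    ?_) ?_) ?_) ?_) ?_).trans ?_
  on_goal 7 =>
    have h2 : x ^ 2 ≤ 1 / 9 := by nlinarith
    have h3 : x ^ 3 ≤ 1 / 27 := by nlinarith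
    linarith
  all_goals positivity

/-- The first Taylor coefficients of a solution of the rescaled functional equation. -/
theorem initial_coeffs {x : ℝ} {b : ℕ → ℝ} (h0 : b 0 = 1)
    (h : (1 - PowerSeries.X) * mk b ^ 2 =
      (1 + x • PowerSeries.X) * expand 2 two_ne_zero (mk fun n => x ^ n * b n)) :
    b 1 = (1 + x) / 2 ∧ b 2 = (3 + 4 * x + x ^ 2) / 8 ∧
      b 3 = (5 + 5 * x + 3 * x ^ 2 + 3 * x ^ 3) / 16 := by
  rw [sub_mul, one_mul, add_mul, one_mul, smul_mul_assoc] at h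
  have c1 := congrArg (PowerSeries.coeff 1) h
  have c2 := congrArg (PowerSeries.coeff 2) h
  have c3 := congrArg (PowerSeries.coeff 3) h
  simp only [map_sub, map_add, PowerSeries.coeff_smul, sq (mk b),
    PowerSeries.coeff_mul (R := ℝ) _ (mk b), PowerSeries.coeff_succ_X_mul,
    PowerSeries.coeff_expand, PowerSeries.coeff_mk, Finset.Nat.antidiagonal_succ] at c1 c2 c3
  norm_num [h0] at c1 c2 c3
  have b1 : b 1 = (1 + x) / 2 := by linarith
  rw [b1] at c2 c3
  have b2 : b 2 = (3 + 4 * x + x ^ 2) / 8 := by linear_combination c2 / 2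
  rw [b2] at c3
  exact ⟨b1, b2, by linear_combination c3 / 2⟩

/-- Splitting off the first terms of the series `M(u) = ∑ x ^ n * b n * u ^ n`. -/
theorem mk_pow_mul_eq (x : ℝ) (b : ℕ → ℝ) :
    (mk fun n => x ^ n * b n) = b 0 • 1 + (x * b 1) • PowerSeries.X +
      (x ^ 2 * b 2) • PowerSeries.X ^ 2 + (x ^ 3 * b 3) • PowerSeries.X ^ 3 +
      x ^ 4 • (PowerSeries.X ^ 4 * mk fun n => x ^ n * b (n + 4)) := by
  ext n
  rcases n with _ | _ | _ | _ | n <;>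
    simp [PowerSeries.coeff_X_pow, PowerSeries.coeff_one, PowerSeries.coeff_X,
      PowerSeries.coeff_X_pow_mul']
  ring

/-- The quotient of a solution of the rescaled functional equation by `(1 - u) ^ (-1 / 2)` has norm
at most `1` apart from its constant term. -/
theorem coeffNorm_mul_sub_one_le {x : ℝ} (hx : 0 ≤ x) (hx3 : x ≤ 1 / 3) {b : ℕ → ℝ}
    (h0 : b 0 = 1) (hb : ∀ n, |b n| ≤ 1) (hb1 : b 1 = (1 + x) / 2) {K : ℝ⟦X⟧}
    (hK0 : PowerSeries.constantCoeff K = 1)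
    (hK : K ^ 2 = (1 + x • PowerSeries.X) * expand 2 two_ne_zero (mk fun n => x ^ n * b n))
    (N : ℕ) : coeffNorm N (K - 1) ≤ 1 := by
  set M := (mk fun n => x ^ n * b n : ℝ⟦X⟧) with hM
  refine coeffNorm_le_one_of_sq (Y := K ^ 2 - 1) (by simp [hK0]) (by ring) (fun N => ?_) N
  have e1 : M - 1 = (x * b 1) • PowerSeries.X ^ 1 +
      x ^ 2 • (PowerSeries.X ^ 2 * mk fun n => x ^ n * b (n + 2)) := by
    ext n
    rcases n with _ | _ | n <;>
      simp [hM, h0, PowerSeries.coeff_one, PowerSeries.coeff_X,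
        PowerSeries.coeff_X_pow_mul']
    ring
  -- `b 1 ≤ 2 / 3` and the series with two terms removed has norm at most `3 / 2`, so the bound is
  -- `2 / 9 + 1 / 6`; the trivial estimate `b 1 ≤ 1` would not suffice below
  have n1 : coeffNorm N (M - 1) ≤ 7 / 18 := by
    have t1 := coeffNorm_smul_X_pow_le N (x * b 1) 1
    have t2 := coeffNorm_X_pow_mul_le N 2 (mk fun n => x ^ n * b (n + 2))
    have t3 := coeffNorm_mk_le hx hx3 (a := fun n => b (n + 2)) (fun n => hb _) N
    have t4 : x ^ 2 * coeffNorm N (PowerSeries.X ^ 2 * mk fun n => x ^ n * b (n + 2)) ≤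
        1 / 9 * (3 / 2) :=
      mul_le_mul (by nlinarith) (t2.trans t3) (coeffNorm_nonneg _ _) (by norm_num)
    rw [hb1, abs_of_nonneg (by positivity)] at t1
    rw [e1]
    refine (coeffNorm_add_le _ _ _).trans ?_
    rw [coeffNorm_smul N (x ^ 2), abs_of_nonneg (sq_nonneg x), hb1]
    nlinarith
  have n2 : coeffNorm N (expand 2 two_ne_zero M - 1) ≤ 7 / 18 := by
    have := coeffNorm_expand_le N (M - 1)
    rw [map_sub, map_one] at this
    exact this.trans n1
  have e2 : K ^ 2 - 1 = (1 + x • PowerSeries.X) * (expand 2 two_ne_zero M - 1) +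
      x • PowerSeries.X ^ 1 := by
    rw [hK]; algebra
  have n3 := coeffNorm_one_add_smul_X_mul_le N x (expand 2 two_ne_zero M - 1)
  have n4 := coeffNorm_smul_X_pow_le N x 1
  rw [abs_of_nonneg hx] at n3 n4
  rw [e2]
  refine (coeffNorm_add_le _ _ _).trans ?_
  nlinarith [coeffNorm_nonneg N (expand 2 two_ne_zero M - 1)]

/-- The expansion of the full generating function, divided by `(1 - u) ^ (-1 / 2)`: with
`K ^ 2 = (1 + x * u) * M(u ^ 2)` and `P = mainPolyB x`, the difference `K - P` is the quotient of
`K ^ 2 - P ^ 2`, which is `O(x ^ 4)`, by `K + P`, which is invertible because `K + P - 2` has norm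
at most `7 / 5`. -/
theorem exists_coeffNorm_sub_mainPolyB_le : ∃ c : ℝ, ∀ (x : ℝ) (b : ℕ → ℝ) (K : ℝ⟦X⟧),
    0 ≤ x → x ≤ 1 / 3 → b 0 = 1 → (∀ n, |b n| ≤ 1) →
    K = mk b * ((1 - PowerSeries.X) * hSeries) →
    (1 - PowerSeries.X) * mk b ^ 2 =
      (1 + x • PowerSeries.X) * expand 2 two_ne_zero (mk fun n => x ^ n * b n) →
    ∀ N, coeffNorm N (K - mainPolyB x) ≤ c * x ^ 4 := by
  obtain ⟨c, hc⟩ := uniformlyBounded_remainderB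
  refine ⟨(c + 2) / (3 / 5), fun x b K hx hx3 h0 hb hKdef hfun N => ?_⟩
  obtain ⟨hb1, hb2, hb3⟩ := initial_coeffs h0 hfun
  have hK : K ^ 2 = (1 + x • PowerSeries.X) * expand 2 two_ne_zero (mk fun n => x ^ n * b n) := by
    rw [hKdef, ← hfun]
    linear_combination (1 - PowerSeries.X) * mk b ^ 2 * one_sub_X_mul_hSeries_sq
  have hK0 : PowerSeries.constantCoeff K = 1 := by
    rw [hKdef]
    have t1 : PowerSeries.constantCoeff (mk b) = 1 := h0
    have t2 : PowerSeries.constantCoeff hSeries = 1 := by simp [hSeries, h]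
    simp [t1, t2]
  have hK1 := coeffNorm_mul_sub_one_le hx hx3 h0 hb hb1 hK0 hK N
  have hP1 := coeffNorm_mainPolyB_sub_one_le hx hx3 N
  set G : ℝ⟦X⟧ := mk fun n => x ^ n * b (n + 4) with hG
  have hR : K ^ 2 - mainPolyB x ^ 2 = x ^ 4 • (remainderB x +
      (1 + x • PowerSeries.X) * (PowerSeries.X ^ 8 * expand 2 two_ne_zero G)) := by
    have e := mainPolyB_sq x
    rw [hK, mk_pow_mul_eq, ← hG, h0, hb1, hb2, hb3]
    simp only [map_add, map_mul, map_pow, map_smul, map_one, PowerSeries.expand_X]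
    rw [← sub_eq_iff_eq_add'] at e
    rw [smul_add, ← e]
    algebra
  have nR : coeffNorm N (K ^ 2 - mainPolyB x ^ 2) ≤ x ^ 4 * (c + 2) := by
    rw [hR, coeffNorm_smul, abs_of_nonneg (by positivity)]
    refine mul_le_mul_of_nonneg_left ?_ (by positivity)
    refine (coeffNorm_add_le _ _ _).trans
      (add_le_add (hc x ⟨hx, hx3.trans (by norm_num)⟩ N) ?_)
    have t1 := coeffNorm_one_add_smul_X_mul_le N x (PowerSeries.X ^ 8 * expand 2 two_ne_zero G)
    have t2 := (coeffNorm_X_pow_mul_le N 8 _).trans (coeffNorm_expand_le N G)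
    have t3 := coeffNorm_mk_le hx hx3 (a := fun n => b (n + 4)) (fun n => hb _) N
    rw [abs_of_nonneg hx] at t1
    nlinarith [coeffNorm_nonneg N (PowerSeries.X ^ 8 * expand 2 two_ne_zero G)]
  have hW : (2 : ℝ) • (K - mainPolyB x) = (K ^ 2 - mainPolyB x ^ 2) -
      (K - mainPolyB x) * ((K - 1) + (mainPolyB x - 1)) := by
    algebra
  have nV : coeffNorm N ((K - 1) + (mainPolyB x - 1)) ≤ 7 / 5 :=
    (coeffNorm_add_le _ _ _).trans (by linarith)
  have nW := coeffNorm_sub_le N (K ^ 2 - mainPolyB x ^ 2)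
      ((K - mainPolyB x) * ((K - 1) + (mainPolyB x - 1)))
  rw [← hW, coeffNorm_smul, abs_of_pos two_pos] at nW
  have nWV := (coeffNorm_mul_le N (K - mainPolyB x) ((K - 1) + (mainPolyB x - 1))).trans
    (mul_le_mul_of_nonneg_left nV (coeffNorm_nonneg _ _))
  rw [div_mul_eq_mul_div, le_div_iff₀ (by norm_num)]
  linarith

/-- The expansion of the squarefree generating function `L / (1 - u) ^ (1 / 2)`, deduced from that
of the full generating function `K / (1 - u) ^ (1 / 2)`. -/
theorem exists_coeffNorm_sub_mainPolyS_le (c : ℝ) : ∃ c' : ℝ, ∀ (x : ℝ) (K L : ℝ⟦X⟧),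
    0 ≤ x → x ≤ 1 / 3 → (∀ N, coeffNorm N (K - mainPolyB x) ≤ c * x ^ 4) →
    (1 - x • PowerSeries.X ^ 2) * K = (1 + x • PowerSeries.X) * L →
    ∀ N, coeffNorm N (L - mainPolyS x) ≤ c' * x ^ 4 := by
  obtain ⟨d, hd⟩ := uniformlyBounded_remainderS
  refine ⟨(4 / 3 * c + d) / (2 / 3), fun x K L hx hx3 hK hL N => ?_⟩
  -- solved for `L - mainPolyS x`; the last term has at most a third of the norm of the left side
  have e : L - mainPolyS x = ((K - mainPolyB x) - x • (PowerSeries.X ^ 2 * (K - mainPolyB x)) +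
      x ^ 4 • remainderS) - x • (PowerSeries.X * (L - mainPolyS x)) := by
    have e1 := mainPolyS_eq x
    rw [← sub_eq_iff_eq_add'] at e1
    rw [← e1, ← sub_eq_zero]
    rw [← sub_eq_zero] at hL
    refine Eq.trans ?_ (neg_eq_zero.2 hL)
    algebra
  have n1 := coeffNorm_smul N x (PowerSeries.X ^ 2 * (K - mainPolyB x))
  have n2 := coeffNorm_X_pow_mul_le N 2 (K - mainPolyB x)
  have n3 := coeffNorm_smul N (x ^ 4) remainderS
  have n4 := hd x ⟨hx, hx3.trans (by norm_num)⟩ N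
  have n5 := coeffNorm_smul N x (PowerSeries.X * (L - mainPolyS x))
  have n6 := coeffNorm_X_mul_le N (L - mainPolyS x)
  have n7 := coeffNorm_sub_le N ((K - mainPolyB x) - x • (PowerSeries.X ^ 2 * (K - mainPolyB x)) +
      x ^ 4 • remainderS) (x • (PowerSeries.X * (L - mainPolyS x)))
  have n8 := coeffNorm_add_le N
    ((K - mainPolyB x) - x • (PowerSeries.X ^ 2 * (K - mainPolyB x))) (x ^ 4 • remainderS)
  have n9 := coeffNorm_sub_le N (K - mainPolyB x) (x • (PowerSeries.X ^ 2 * (K - mainPolyB x)))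
  rw [← e] at n7
  have hx4 : 0 ≤ x ^ 4 := by positivity
  rw [abs_of_nonneg hx] at n1 n5
  rw [abs_of_nonneg hx4] at n3
  have m1 : x * coeffNorm N (PowerSeries.X ^ 2 * (K - mainPolyB x)) ≤ 1 / 3 * (c * x ^ 4) :=
    mul_le_mul hx3 (n2.trans (hK N)) (coeffNorm_nonneg _ _) (by norm_num)
  have m2 : x ^ 4 * coeffNorm N remainderS ≤ x ^ 4 * d := mul_le_mul_of_nonneg_left n4 hx4
  have m3 : x * coeffNorm N (PowerSeries.X * (L - mainPolyS x)) ≤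
      1 / 3 * coeffNorm N (L - mainPolyS x) :=
    mul_le_mul hx3 n6 (coeffNorm_nonneg _ _) (by norm_num)
  have m4 := hK N
  rw [div_mul_eq_mul_div, le_div_iff₀ (by norm_num)]
  linarith

theorem coeff_X_pow_mul_hSeries (n k : ℕ) :
    PowerSeries.coeff n (PowerSeries.X ^ k * hSeries) = h ((n : ℤ) - k) := by
  rw [PowerSeries.coeff_X_pow_mul']
  split_ifs with hk
  · rw [hSeries, PowerSeries.coeff_mk, Nat.cast_sub hk]
  -- for `k > n` the index is negative and `h` vanishes
  · rw [h, if_neg (by omega)]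

theorem mainB_eq {q : ℝ} (hq : q ≠ 0) (n : ℕ) :
    mainB q n = q ^ n * PowerSeries.coeff n (mainPolyB q⁻¹ * hSeries) := by
  have e : ∀ k : ℕ, PowerSeries.coeff n (PowerSeries.X ^ k * hSeries) = h ((n : ℤ) - k) :=
    coeff_X_pow_mul_hSeries n
  have e0 := e 0
  have e1 := e 1
  rw [pow_zero, one_mul] at e0
  rw [pow_one] at e1
  simp only [mainPolyB, add_mul, one_mul, smul_mul_assoc, map_add, PowerSeries.coeff_smul, e, e0,
    e1, mainB, zpow_sub₀ hq, smul_eq_mul, zpow_natCast]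
  push_cast
  norm_num
  field_simp
  ring

theorem mainS_eq {q : ℝ} (hq : q ≠ 0) (n : ℕ) :
    mainS q n = q ^ n * PowerSeries.coeff n (mainPolyS q⁻¹ * hSeries) := by
  have e : ∀ k : ℕ, PowerSeries.coeff n (PowerSeries.X ^ k * hSeries) = h ((n : ℤ) - k) :=
    coeff_X_pow_mul_hSeries n
  have e0 := e 0
  have e1 := e 1
  rw [pow_zero, one_mul] at e0
  rw [pow_one] at e1
  simp only [mainPolyS, add_mul, one_mul, smul_mul_assoc, map_add, PowerSeries.coeff_smul, e, e0,
    e1, mainS, zpow_sub₀ hq, smul_eq_mul, zpow_natCast]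
  push_cast
  norm_num
  field_simp
  ring

/-- From a bound for `K - P` to the error term of the coefficients of `K * (1 - u) ^ (-1 / 2)`. -/
theorem abs_sub_le_of_coeffNorm_le {q c a : ℝ} (hq : 0 < q) {n : ℕ} {K P : ℝ⟦X⟧}
    (hK : PowerSeries.coeff n (K * hSeries) = q⁻¹ ^ n * a)
    (h : coeffNorm n (K - P) ≤ c * q⁻¹ ^ 4) :
    |a - q ^ n * PowerSeries.coeff n (P * hSeries)| ≤ c * q ^ ((n : ℤ) - 4) := by
  have h1 := (abs_coeff_mul_le n (K - P) abs_coeff_hSeries_le).trans h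
  rw [sub_mul, map_sub, hK] at h1
  have h2 : a - q ^ n * PowerSeries.coeff n (P * hSeries) =
      q ^ n * (q⁻¹ ^ n * a - PowerSeries.coeff n (P * hSeries)) := by
    have h3 : q ^ n * q⁻¹ ^ n = 1 := by rw [← mul_pow, mul_inv_cancel₀ hq.ne', one_pow]
    linear_combination (-a) * h3
  rw [h2, abs_mul, abs_of_pos (pow_pos hq n), zpow_sub₀ hq.ne', zpow_natCast]
  refine (mul_le_mul_of_nonneg_left h1 (pow_pos hq n).le).trans_eq ?_
  norm_cast
  field_simp

end Expansion

/-! ### The count without the sign -/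

section Unsigned
variable {F : Type*} [Field F]

theorem countSUnsigned_eq (n : ℕ) (h : Even n ∨ IsSquare (-1 : F)) :
    countSUnsigned F n = countS F n := by
  have key : ∀ f : F[X], IsMinusForm ((-1) ^ n * f) ↔ IsMinusForm f := by
    intro f
    rcases Nat.even_or_odd n with hn | hn
    · rw [hn.neg_one_pow, one_mul]
    · have hsq := h.resolve_left (Nat.not_even_iff_odd.2 hn)
      rw [hn.neg_one_pow, neg_one_mul, isMinusForm_neg_iff hsq]
  simp only [countSUnsigned, countS, key]

end Unsigned

/-! ### Rescaled functional equations -/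

section Rescaled
open scoped PowerSeries
open PowerSeries (mk expand)

theorem rescale_C (x a : ℝ) : PowerSeries.rescale x (PowerSeries.C a) = PowerSeries.C a := by
  ext n
  rw [PowerSeries.coeff_rescale, PowerSeries.coeff_C]
  split_ifs with hn
  · rw [hn, pow_zero, one_mul]
  · rw [mul_zero]

variable (F : Type*) [Field F] [Fintype F]

theorem rescale_genB_functional (hF : Odd (Fintype.card F)) {x : ℝ}
    (hx : (Fintype.card F : ℝ) * x = 1) :
    (1 - PowerSeries.X) * (mk fun n => x ^ n * (countB F n : ℝ)) ^ 2 =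
      (1 + x • PowerSeries.X) *
        expand 2 two_ne_zero (mk fun n => x ^ n * (x ^ n * (countB F n : ℝ))) := by
  have key := congrArg (PowerSeries.rescale x) (genB_functional (F := F) hF)
  have e1 : PowerSeries.rescale x (genB F) = mk fun n => x ^ n * (countB F n : ℝ) := by
    ext n; simp [genB, PowerSeries.coeff_rescale]
  have e2 : PowerSeries.rescale x (expand 2 two_ne_zero (genB F)) =
      expand 2 two_ne_zero (mk fun n => x ^ n * (x ^ n * (countB F n : ℝ))) := by
    ext n
    rw [PowerSeries.coeff_rescale, PowerSeries.coeff_expand, PowerSeries.coeff_expand]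
    split_ifs with hn
    · obtain ⟨m, rfl⟩ := hn
      rw [Nat.mul_div_cancel_left _ two_pos, genB, PowerSeries.coeff_mk, PowerSeries.coeff_mk]
      ring
    · simp
  have e3 : PowerSeries.C (Fintype.card F : ℝ) * (PowerSeries.C x * PowerSeries.X) =
      (PowerSeries.X : ℝ⟦X⟧) := by
    rw [← mul_assoc, ← map_mul, hx, map_one, one_mul]
  simp only [map_mul, map_pow, map_sub, map_add, map_one, e1, e2, PowerSeries.rescale_X,
    rescale_C, e3] at key
  rw [key, PowerSeries.smul_eq_C_mul]

theorem rescale_genS_functional (hF : Odd (Fintype.card F)) {x : ℝ}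
    (hx : (Fintype.card F : ℝ) * x = 1) :
    (1 - x • PowerSeries.X ^ 2) * (mk fun n => x ^ n * (countB F n : ℝ)) =
      (1 + x • PowerSeries.X) * mk fun n => x ^ n * (countS F n : ℝ) := by
  have key := congrArg (PowerSeries.rescale x) (genS_functional (F := F) hF)
  have e3 : PowerSeries.C (Fintype.card F : ℝ) * (PowerSeries.C x * PowerSeries.X) ^ 2 =
      (PowerSeries.C x * PowerSeries.X ^ 2 : ℝ⟦X⟧) := by
    have : PowerSeries.C (Fintype.card F : ℝ) * PowerSeries.C x = 1 := by
      rw [← map_mul, hx, map_one]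
    linear_combination PowerSeries.C x * PowerSeries.X ^ 2 * this
  simp only [map_mul, map_pow, map_sub, map_add, map_one, genB, genS, PowerSeries.rescale_mk,
    PowerSeries.rescale_X, rescale_C, e3] at key
  rw [PowerSeries.smul_eq_C_mul, PowerSeries.smul_eq_C_mul, key]

end Rescaled
end NormCount

theorem mainTheorem4 :
    ∃ C : ℝ, ∀ (F : Type*) [Field F] [Fintype F], Odd (Fintype.card F) → ∀ n : ℕ,
      |(NormCount.countS F n : ℝ) - NormCount.mainS (Fintype.card F) n|
          ≤ C * (Fintype.card F : ℝ) ^ ((n : ℤ) - 4) ∧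
      (Even n ∨ IsSquare (-1 : F) →
        |(NormCount.countSUnsigned F n : ℝ) - NormCount.mainS (Fintype.card F) n|
          ≤ C * (Fintype.card F : ℝ) ^ ((n : ℤ) - 4)) ∧
      |(NormCount.countB F n : ℝ) - NormCount.mainB (Fintype.card F) n|
          ≤ C * (Fintype.card F : ℝ) ^ ((n : ℤ) - 4) := by
  obtain ⟨c, hc⟩ := NormCount.exists_coeffNorm_sub_mainPolyB_le
  obtain ⟨c', hc'⟩ := NormCount.exists_coeffNorm_sub_mainPolyS_le c
  refine ⟨max c c', fun F _ _ hF n => ?_⟩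
  have hq3 : (3 : ℝ) ≤ Fintype.card F := by
    have h1 : 1 < Fintype.card F := Fintype.one_lt_card
    have h2 := Nat.odd_iff.1 hF
    have : 3 ≤ Fintype.card F := by omega
    exact_mod_cast this
  have hq : (0 : ℝ) < Fintype.card F := by linarith
  have hx : (Fintype.card F : ℝ) * (Fintype.card F : ℝ)⁻¹ = 1 := mul_inv_cancel₀ hq.ne'
  have hx0 : 0 ≤ (Fintype.card F : ℝ)⁻¹ := by positivity
  have hx3 : (Fintype.card F : ℝ)⁻¹ ≤ 1 / 3 := by
    rw [one_div]; exact inv_anti₀ (by norm_num) hq3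
  have hfunB := NormCount.rescale_genB_functional F hF hx
  have hfunS := NormCount.rescale_genS_functional F hF hx
  have hB := hc _ (fun n => (Fintype.card F : ℝ)⁻¹ ^ n * (NormCount.countB F n : ℝ)) _ hx0 hx3
    (by simp [NormCount.countB_zero]) (fun n => by
      have h1 : (NormCount.countB F n : ℝ) ≤ (Fintype.card F : ℝ) ^ n := by
        exact_mod_cast NormCount.countB_le F n
      rw [abs_of_nonneg (by positivity), inv_pow, inv_mul_le_one₀ (by positivity)]
      exact h1) rfl hfunB
  have hS := hc' _ _ (PowerSeries.mk (fun n =>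
      (Fintype.card F : ℝ)⁻¹ ^ n * (NormCount.countS F n : ℝ)) *
        ((1 - PowerSeries.X) * NormCount.hSeries)) hx0 hx3 hB (by
      linear_combination (1 - PowerSeries.X) * NormCount.hSeries * hfunS)
  have hcoeff : ∀ a : ℕ → ℝ, PowerSeries.coeff n (PowerSeries.mk a *
      ((1 - PowerSeries.X) * NormCount.hSeries) * NormCount.hSeries) = a n := by
    intro a
    have : PowerSeries.mk a * ((1 - PowerSeries.X) * NormCount.hSeries) * NormCount.hSeries =
        PowerSeries.mk a := by
      linear_combination PowerSeries.mk a * NormCount.one_sub_X_mul_hSeries_sq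
    rw [this, PowerSeries.coeff_mk]
  have boundB := NormCount.abs_sub_le_of_coeffNorm_le hq (hcoeff _) (hB n)
  have boundS := NormCount.abs_sub_le_of_coeffNorm_le hq (hcoeff _) (hS n)
  rw [← NormCount.mainB_eq hq.ne'] at boundB
  rw [← NormCount.mainS_eq hq.ne'] at boundS
  have hpow : (0 : ℝ) ≤ (Fintype.card F : ℝ) ^ ((n : ℤ) - 4) := by positivity
  have boundS' := boundS.trans (mul_le_mul_of_nonneg_right (le_max_right c c') hpow)
  refine ⟨boundS', fun h => ?_, boundB.trans (mul_le_mul_of_nonneg_right (le_max_left c c') hpow)⟩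
  rw [NormCount.countSUnsigned_eq n h]
  exact boundS'
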